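/- For a graph $G$ and a graph $T$ let $\mathcal N(T,G)$ denote the number of (not necessarily induced) subgraphs of $G$ isomorphic to $T$, let $P_\ell$ denote the path with $\ell$ edges, and let $\mathrm{ex}(n,T,H)$ denote the maximum of $\mathcal N(T,G)$ over all $n$-vertex graphs $G$ that contain no (not necessarily induced) copy of $H$. For $k\ge 5$ put $t=\lfloor (k-1)/2\rfloor$, and for $n\ge k$ let $G_{n,k,t}$ be the $n$-vertex graph whose vertex set is partitioned into classes $A,B,C$ with $|A|=t$, $|B|=n-k+t$, $|C|=k-2t$, in which $A\cup C$ is a clique, $B$ is an independent set, all pairs between $A$ and $B$ are edges, and there are no edges between $B$ and $C$. Theorem. For every integer $k\ge 5$ there exists $n_1\in\mathbb N$ such that for all $n\ge n_1$ $$\mathrm{ex}(n,P_4,P_k)=\mathcal N(P_4,G_{n,k,t}),$$ and, as $n\to\infty$ with $k$ fixed, $$\mathrm{ex}(n,P_4,P_k)=\frac{t(t-1)}{2}\,n^3+O(n^2).$$ Moreover, for all $n\ge n_1$: if $k\ge 6$, then $G_{n,k,t}$ is, up to isomorphism, the only $n$-vertex $P_k$-free graph with $\mathrm{ex}(n,P_4,P_k)$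 copies of $P_4$; if $k=5$ (so $t=2$), there are, up to isomorphism, exactly two such graphs, $G_{n,5,2}$ and the complete bipartite graph $K_{2,n-2}$. -/

import Mathlib

open Filter Asymptotics

/-- The path with `ℓ` edges, that is, on `ℓ + 1` vertices. -/
def edgePath (ℓ : ℕ) : SimpleGraph (Fin (ℓ + 1)) :=
  SimpleGraph.pathGraph (ℓ + 1)

open scoped Classical in
/-- The generalized extremal number: the maximum number of (not necessarily induced, unlabelled)
copies of `T` in an `H`-free graph on `n` vertices. -/
noncomputable def genExtremalNumber (n : ℕ) {U W : Type*}
    (T : SimpleGraph U) (H : SimpleGraph W) : ℕ :=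
  Finset.sup {G : SimpleGraph (Fin n) | H.Free G} (fun G => G.copyCount T)

/-- `G` is an `H`-free graph on `n` labelled vertices with the maximum number of copies of `T`. -/
def IsGenExtremal {n : ℕ} {U W : Type*} (T : SimpleGraph U) (H : SimpleGraph W)
    (G : SimpleGraph (Fin n)) : Prop :=
  H.Free G ∧ G.copyCount T = genExtremalNumber n T H

/-- The graph `G_{n,k,a}` (for `2 * a ≤ k` and `k ≤ n + a`). The vertex set is partitioned into
`A = {i | i < a}`, `C = {i | a ≤ i < k - a}` and `B = {i | k - a ≤ i < n}`, of sizes `a`,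
`k - 2 * a` and `n - k + a`. The set `A ∪ C` is a clique, `B` is independent, all pairs between
`A` and `B` are edges, and there are no edges between `B` and `C`. -/
def kopylovGraph (n k a : ℕ) : SimpleGraph (Fin n) where
  Adj i j := i ≠ j ∧ (i.val < a ∨ j.val < a ∨ (i.val < k - a ∧ j.val < k - a))
  symm := ⟨fun _ _ h => ⟨h.1.symm, by tauto⟩⟩
  loopless := ⟨fun _ h => h.1 rfl⟩

/-
Count the paths with four edges as ordered quintuples, so that each of them is counted twice. In a
`P_k`-free graph the second and the fourth vertex of almost all quintuples have high degree, and
only boundedly many vertices have more than `t` neighbours of high degree. Hence a graph with about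
`t (t - 1) n ^ 3` quintuples has a set `A` of `t` vertices of degree `(1 - o(1)) n`. Take the
vertices outside `A` that are not adjacent to all of `A`, delete their edges and join them to all
of `A`: the graph stays `P_k`-free, `Ω(n ^ 2)` quintuples are gained per vertex, and only a smaller
number is lost. In an extremal graph `A` is therefore completely joined to its complement, which
then spans at most one edge, and none unless `k = 2 t + 2`. So the graph lies between `K_{t,n-t}`
and `G_{n,k,t}`. Every edge of `G_{n,k,t}` missing from `K_{t,n-t}` lies on a path with four edges,
except for `k = 5`, where the edge inside `A` lies on none.
-/

section Copies

open SimpleGraph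

variable {V W U : Type*}

lemma bijective_coeCopy_comp (G : SimpleGraph V) (H : SimpleGraph W) :
    Function.Bijective fun x : Σ G' : {G' : G.Subgraph // Nonempty (H ≃g G'.coe)}, H ≃g G'.1.coe =>
      x.1.1.coeCopy.comp x.2.toCopy := by
  have htoSubgraph (G' : G.Subgraph) (e : H ≃g G'.coe) :
      (G'.coeCopy.comp e.toCopy).toSubgraph = G' := by
    change Subgraph.map (G'.hom.comp e.toHom) ⊤ = G'
    simp [Subgraph.map_comp]
  refine ⟨?_, fun f => ⟨⟨⟨f.toSubgraph, ⟨f.isoToSubgraph⟩⟩, f.isoToSubgraph⟩, rfl⟩⟩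
  rintro ⟨⟨G₁, h₁⟩, e₁⟩ ⟨⟨G₂, h₂⟩, e₂⟩ h
  obtain rfl : G₁ = G₂ := by
    rw [← htoSubgraph G₁ e₁, ← htoSubgraph G₂ e₂]
    exact congrArg Copy.toSubgraph h
  obtain rfl : e₁ = e₂ := by
    ext x
    exact congrArg (fun f : Copy H G => f x) h
  rfl

lemma card_copy_eq_copyCount_mul [Fintype V] (G : SimpleGraph V) (H : SimpleGraph W) :
    Nat.card (Copy H G) = G.copyCount H * Nat.card (H ≃g H) := by
  classical
  have e (G' : {G' : G.Subgraph // Nonempty (H ≃g G'.coe)}) : (H ≃g G'.1.coe) ≃ (H ≃g H) :=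
    { toFun := fun f => f.trans G'.2.some.symm
      invFun := fun f => f.trans G'.2.some
      left_inv := fun f => by ext; simp
      right_inv := fun f => by ext; simp }
  rw [← Nat.card_congr (Equiv.ofBijective _ (bijective_coeCopy_comp G H)),
    Nat.card_congr ((Equiv.sigmaCongrRight e).trans (Equiv.sigmaEquivProd _ _)), Nat.card_prod,
    copyCount, Nat.card_eq_fintype_card, Fintype.card_subtype]

end Copies

section PathAutomorphisms

open SimpleGraph

variable {ℓ : ℕ}

lemma edgePath_adj {i j : Fin (ℓ + 1)} :
    (edgePath ℓ).Adj i j ↔ i.val + 1 = j.val ∨ j.val + 1 = i.val :=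
  pathGraph_adj

/-- The reversal of a path, as an automorphism. -/
def edgePathRev (ℓ : ℕ) : edgePath ℓ ≃g edgePath ℓ where
  toEquiv := Fin.revPerm
  map_rel_iff' := by simp [edgePath_adj, Fin.val_rev]; omega

lemma edgePath_iso_eq_refl_of_apply_zero {σ : edgePath ℓ ≃g edgePath ℓ} (h₀ : σ 0 = 0) :
    σ = .refl := by
  have hσ (i : ℕ) (hi : i < ℓ + 1) : σ ⟨i, hi⟩ = ⟨i, hi⟩ := by
    induction i using Nat.strong_induction_on with
    | _ i ih =>
    rcases i with _ | i
    · exact h₀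
    have hadj : (edgePath ℓ).Adj (σ ⟨i, by omega⟩) (σ ⟨i + 1, hi⟩) :=
      σ.map_adj_iff.2 (edgePath_adj.2 (Or.inl rfl))
    rw [ih i (by omega), edgePath_adj] at hadj
    rcases hadj with h | h
    · exact Fin.ext h.symm
    · have := ih (i - 1) (by omega) (by omega)
      have hinj : (⟨i - 1, by omega⟩ : Fin (ℓ + 1)) = ⟨i + 1, hi⟩ :=
        σ.injective (this.trans (Fin.ext (by simp only at h ⊢; omega)))
      simp only [Fin.mk.injEq] at hinj
      omega
  ext i
  exact congrArg Fin.val (hσ i i.2)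

lemma edgePath_iso_apply_zero (σ : edgePath ℓ ≃g edgePath ℓ) : σ 0 = 0 ∨ σ 0 = Fin.last ℓ := by
  by_contra! h
  obtain ⟨h₀, hℓ⟩ := h
  have hpos : 0 < (σ 0).val := Nat.pos_of_ne_zero fun h => h₀ (Fin.ext h)
  have hlt : (σ 0).val < ℓ := Fin.val_lt_last hℓ
  have hpre (j : Fin (ℓ + 1)) (hj : (edgePath ℓ).Adj (σ 0) j) : (σ.symm j).val = 1 := by
    have hadj := σ.symm.map_adj_iff.2 hj
    rw [RelIso.symm_apply_apply, edgePath_adj] at hadj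
    simpa [eq_comm] using hadj
  have hpred := hpre ⟨(σ 0).val - 1, by omega⟩ (edgePath_adj.2 (Or.inr (by simp only; omega)))
  have hsucc := hpre ⟨(σ 0).val + 1, by omega⟩ (edgePath_adj.2 (Or.inl rfl))
  have heq := σ.symm.injective (Fin.ext (hpred.trans hsucc.symm))
  simp only [Fin.mk.injEq] at heq
  omega

lemma card_edgePath_iso (hℓ : ℓ ≠ 0) : Nat.card (edgePath ℓ ≃g edgePath ℓ) = 2 := by
  refine Nat.card_eq_two_iff.2 ⟨.refl, edgePathRev ℓ, fun h => ?_, ?_⟩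
  · have : (0 : Fin (ℓ + 1)) = Fin.rev 0 := congrArg (fun σ : edgePath ℓ ≃g edgePath ℓ => σ 0) h
    rw [Fin.rev_zero, Fin.ext_iff] at this
    exact hℓ this.symm
  · refine Set.eq_univ_of_forall fun σ => ?_
    rcases edgePath_iso_apply_zero σ with h | h
    · exact Or.inl (edgePath_iso_eq_refl_of_apply_zero h)
    · have hzero : σ.trans (edgePathRev ℓ) 0 = 0 := by
        change Fin.rev (σ 0) = 0
        rw [h, Fin.rev_last]
      have hrev := edgePath_iso_eq_refl_of_apply_zero hzero
      refine Or.inr (RelIso.ext fun i => ?_)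
      exact Fin.rev_eq_iff.1 (congrArg (fun τ : edgePath ℓ ≃g edgePath ℓ => τ i) hrev)

end PathAutomorphisms

section PathTuples

open SimpleGraph

variable {V W : Type*} [Fintype V] [Fintype W]

open Classical in
/-- The quintuples of distinct vertices that trace a path with four edges in `G`; each copy of
`edgePath 4` is traced by two of them. -/
noncomputable def pathTuples (G : SimpleGraph V) : Finset (V × V × V × V × V) :=
  {x | (G.Adj x.1 x.2.1 ∧ G.Adj x.2.1 x.2.2.1 ∧ G.Adj x.2.2.1 x.2.2.2.1 ∧
      G.Adj x.2.2.2.1 x.2.2.2.2) ∧ [x.1, x.2.1, x.2.2.1, x.2.2.2.1, x.2.2.2.2].Nodup}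

lemma mem_pathTuples {G : SimpleGraph V} {a b c d e : V} :
    (a, b, c, d, e) ∈ pathTuples G ↔
      (G.Adj a b ∧ G.Adj b c ∧ G.Adj c d ∧ G.Adj d e) ∧ [a, b, c, d, e].Nodup := by
  simp only [pathTuples, Finset.mem_filter, Finset.mem_univ, true_and]

lemma mem_pathTuples_reverse {G : SimpleGraph V} {a b c d e : V}
    (h : (a, b, c, d, e) ∈ pathTuples G) : (e, d, c, b, a) ∈ pathTuples G := by
  obtain ⟨⟨hab, hbc, hcd, hde⟩, hnodup⟩ := mem_pathTuples.1 h
  exact mem_pathTuples.2 ⟨⟨hde.symm, hcd.symm, hbc.symm, hab.symm⟩, List.nodup_reverse.2 hnodup⟩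

lemma pathTuples_mono {G G' : SimpleGraph V} (h : G ≤ G') : pathTuples G ⊆ pathTuples G' := by
  rintro ⟨a, b, c, d, e⟩ hx
  rw [mem_pathTuples] at hx ⊢
  exact ⟨⟨h hx.1.1, h hx.1.2.1, h hx.1.2.2.1, h hx.1.2.2.2⟩, hx.2⟩

/-- The quintuples in `pathTuples G` are the labelled copies of the path with four edges. -/
def copyEquivPathTuples (G : SimpleGraph V) : Copy (edgePath 4) G ≃ pathTuples G where
  toFun f := ⟨(f 0, f 1, f 2, f 3, f 4), by
    have hadj (i j : Fin 5) (h : i.val + 1 = j.val) : G.Adj (f i) (f j) :=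
      f.toHom.map_adj (edgePath_adj.2 (Or.inl h))
    refine mem_pathTuples.2 ⟨⟨hadj 0 1 rfl, hadj 1 2 rfl, hadj 2 3 rfl, hadj 3 4 rfl⟩, ?_⟩
    exact (List.nodup_finRange 5).map f.injective⟩
  invFun x := ⟨⟨![x.1.1, x.1.2.1, x.1.2.2.1, x.1.2.2.2.1, x.1.2.2.2.2], fun {i j} hij => by
      obtain ⟨⟨a, b, c, d, e⟩, hx⟩ := x
      obtain ⟨⟨hab, hbc, hcd, hde⟩, -⟩ := mem_pathTuples.1 hx
      rw [edgePath_adj] at hij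
      fin_cases i <;> fin_cases j <;> simp at hij <;>
        simp [hab, hbc, hcd, hde, hab.symm, hbc.symm, hcd.symm, hde.symm]⟩, by
      obtain ⟨⟨a, b, c, d, e⟩, hx⟩ := x
      exact List.nodup_ofFn.1 (by simpa [List.ofFn_succ] using (mem_pathTuples.1 hx).2)⟩
  left_inv f := by
    ext i
    fin_cases i <;> rfl
  right_inv _ := rfl

lemma card_pathTuples_eq_card_copy (G : SimpleGraph V) :
    (pathTuples G).card = Nat.card (Copy (edgePath 4) G) := by
  rw [Nat.card_congr (copyEquivPathTuples G), Nat.card_eq_fintype_card, Fintype.card_coe]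

lemma card_pathTuples (G : SimpleGraph V) :
    (pathTuples G).card = G.copyCount (edgePath 4) * 2 := by
  rw [card_pathTuples_eq_card_copy, card_copy_eq_copyCount_mul, card_edgePath_iso four_ne_zero]

lemma card_pathTuples_congr {G : SimpleGraph V} {H : SimpleGraph W} (φ : G ≃g H) :
    (pathTuples G).card = (pathTuples H).card := by
  rw [card_pathTuples_eq_card_copy, card_pathTuples_eq_card_copy]
  exact Nat.card_congr
    { toFun := φ.toCopy.comp
      invFun := φ.symm.toCopy.comp
      left_inv := fun f => by ext; simp
      right_inv := fun f => by ext; simp }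

/-- A `P_k`-free graph on a finite vertex set with the maximum number of paths with four edges,
the paths being counted as quintuples. -/
def IsPathExtremal (k : ℕ) (G : SimpleGraph V) : Prop :=
  (edgePath k).Free G ∧ ∀ G' : SimpleGraph V, (edgePath k).Free G' →
    (pathTuples G').card ≤ (pathTuples G).card

lemma isGenExtremal_iff {n k : ℕ} {G : SimpleGraph (Fin n)} :
    IsGenExtremal (edgePath 4) (edgePath k) G ↔ IsPathExtremal k G := by
  classical
  have hle (G' : SimpleGraph (Fin n)) (h : (edgePath k).Free G') :
      G'.copyCount (edgePath 4) ≤ genExtremalNumber n (edgePath 4) (edgePath k) :=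
    Finset.le_sup (f := fun G : SimpleGraph (Fin n) => G.copyCount (edgePath 4)) (by simpa using h)
  simp only [IsPathExtremal, card_pathTuples, Nat.mul_le_mul_right_iff two_pos]
  refine and_congr_right fun hfree => ⟨fun h G' hG' => h ▸ hle G' hG', fun h => ?_⟩
  exact (hle G hfree).antisymm (Finset.sup_le fun G' hG' => h G' (by simpa using hG'))

lemma IsPathExtremal.congr {k : ℕ} {G H : SimpleGraph V} (φ : G ≃g H)
    (hG : IsPathExtremal k G) : IsPathExtremal k H :=
  ⟨(free_congr_right φ).1 hG.1, fun G' hG' => (hG.2 G' hG').trans_eq (card_pathTuples_congr φ)⟩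

lemma exists_isPathExtremal {k : ℕ} {G : SimpleGraph V} (h : (edgePath k).Free G) :
    ∃ G' : SimpleGraph V, IsPathExtremal k G' := by
  classical
  obtain ⟨G', hG', hmax⟩ := Finset.exists_max_image
    ({G | (edgePath k).Free G} : Finset (SimpleGraph V)) (fun G => (pathTuples G).card)
    ⟨G, by simpa using h⟩
  simp only [Finset.mem_filter, Finset.mem_univ, true_and] at hG' hmax
  exact ⟨G', hG', hmax⟩

end PathTuples

section PathFree

open SimpleGraph

variable {V : Type*} {G : SimpleGraph V} {k : ℕ}

lemma length_lt_of_edgePath_free (hfree : (edgePath k).Free G) {u v : V} {p : G.Walk u v}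
    (hp : p.IsPath) : p.length < k := by
  by_contra! hk
  have hcontained := (hp.take k).isContained_pathGraph
  rw [Walk.take_length, min_eq_left hk] at hcontained
  exact hfree hcontained

lemma exists_isPath_of_isCompleteBetween {A B : Finset V} (hAB : G.IsCompleteBetween A B)
    (hcard : A.card ≤ B.card) {a : V} (ha : a ∈ A) :
    ∃ (b : V) (p : G.Walk a b), p.IsPath ∧ p.length + 1 = 2 * A.card ∧
      ∀ x ∈ p.support, x ∈ A ∨ x ∈ B := by
  classical
  induction h : A.card generalizing A B a with
  | zero => simp_all
  | succ m ih =>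
    obtain ⟨b, hb⟩ : B.Nonempty := Finset.card_pos.1 (by omega)
    have hab := hAB ha hb
    have hcardA := Finset.card_erase_of_mem ha
    have hcardB := Finset.card_erase_of_mem hb
    rcases (A.erase a).eq_empty_or_nonempty with hA | ⟨a', ha'⟩
    · rw [hA, Finset.card_empty] at hcardA
      refine ⟨b, hab.toWalk, Walk.IsPath.of_adj hab, ?_, ?_⟩
      · simp only [Walk.length_cons, Walk.length_nil]
        omega
      · simp [ha, hb]
    have hab' := hAB (Finset.mem_of_mem_erase ha') hb
    obtain ⟨b', p, hp, hlength, hsupport⟩ := ih (A := A.erase a) (B := B.erase b)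
      (fun x hx y hy => hAB (Finset.mem_of_mem_erase hx) (Finset.mem_of_mem_erase hy))
      (by omega) ha' (by omega)
    have haB : a ∉ B := fun h => Set.disjoint_left.1 hAB.disjoint ha h
    have hbA : b ∉ A := fun h => Set.disjoint_left.1 hAB.disjoint h hb
    refine ⟨b', .cons hab (.cons hab'.symm p), ?_, ?_, ?_⟩
    · have hap : a ∉ p.support := fun h => by simpa [haB] using hsupport a h
      have hbp : b ∉ p.support := fun h => by simpa [hbA] using hsupport b h
      simp [Walk.cons_isPath_iff, hp, hap, hbp, hab.ne]
    · simp only [Walk.length_cons]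
      omega
    · simp only [Walk.support_cons, List.mem_cons]
      rintro x (rfl | rfl | hx)
      · exact Or.inl ha
      · exact Or.inr hb
      · exact (hsupport x hx).imp Finset.mem_of_mem_erase Finset.mem_of_mem_erase

lemma isPath_append {u v w : V} {p : G.Walk u v} {q : G.Walk v w} (hp : p.IsPath) (hq : q.IsPath)
    (hpq : ∀ x ∈ p.support, x ∈ q.support → x = v) : (p.append q).IsPath := by
  rw [Walk.isPath_def, Walk.support_append, List.nodup_append']
  refine ⟨hp.support_nodup, hq.support_nodup.sublist q.support.tail_sublist, fun x hx hx' => ?_⟩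
  obtain rfl := hpq x hx (List.mem_of_mem_tail hx')
  have hnodup := hq.support_nodup
  rw [← Walk.cons_tail_support] at hnodup
  exact (List.nodup_cons.1 hnodup).1 hx'

/-- The basic obstruction in a `P_k`-free graph: a path that ends in the smaller class `A` of a
complete bipartite subgraph can be continued through all of `A`. -/
lemma length_add_two_mul_card_le {A B : Finset V} (hfree : (edgePath k).Free G)
    (hAB : G.IsCompleteBetween A B) {v a : V} {p : G.Walk v a} (hp : p.IsPath) (ha : a ∈ A)
    (hpA : ∀ x ∈ p.support, x ∈ A → x = a) (hcard : A.card + p.length ≤ B.card) :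
    p.length + 2 * A.card ≤ k := by
  classical
  have haB : a ∉ B := fun h => Set.disjoint_left.1 hAB.disjoint ha h
  have hsupport : A.card ≤ (B \ p.support.toFinset).card := by
    have hinter : B ∩ p.support.toFinset ⊆ p.support.toFinset.erase a := fun x hx =>
      Finset.mem_erase.2 ⟨fun h => haB (h ▸ (Finset.mem_inter.1 hx).1), (Finset.mem_inter.1 hx).2⟩
    have hle := Finset.card_le_card hinter
    rw [Finset.card_erase_of_mem (by simp), List.toFinset_card_of_nodup hp.support_nodup,
      Walk.length_support, Nat.add_sub_cancel] at hle
    have := Finset.card_sdiff_add_card_inter B p.support.toFinset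
    omega
  obtain ⟨b, q, hq, hlength, hmem⟩ := exists_isPath_of_isCompleteBetween
    (B := B \ p.support.toFinset) (fun x hx y hy => hAB hx (Finset.mem_sdiff.1 hy).1) hsupport ha
  have hpq : (p.append q).IsPath := isPath_append hp hq fun x hx hx' =>
    hpA x hx ((hmem x hx').resolve_right fun h => (Finset.mem_sdiff.1 h).2 (by simpa using hx))
  have := length_lt_of_edgePath_free hfree hpq
  rw [Walk.length_append] at this
  omega

lemma exists_card_filter_adj_lt [DecidableRel G.Adj] (hfree : (edgePath k).Free G)
    {S : Finset V} (hS : S.Nonempty) : ∃ v ∈ S, {w ∈ S | G.Adj v w}.card < k := by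
  classical
  let P (ℓ : ℕ) : Prop := ∃ u v, ∃ p : G.Walk u v, p.IsPath ∧ (∀ x ∈ p.support, x ∈ S) ∧
    p.length = ℓ
  obtain ⟨s, hs⟩ := hS
  have hzero : P 0 := ⟨s, s, .nil, .nil, by simpa using hs, rfl⟩
  obtain ⟨u, v, p, hp, hpS, hlength⟩ := Nat.findGreatest_spec (P := P) (Nat.zero_le k) hzero
  refine ⟨u, hpS u p.start_mem_support, ?_⟩
  have hsub : {w ∈ S | G.Adj u w} ⊆ p.support.toFinset.erase u := fun w hw => by
    obtain ⟨hwS, hadj⟩ := Finset.mem_filter.1 hw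
    refine Finset.mem_erase.2 ⟨hadj.ne', List.mem_toFinset.2 ?_⟩
    by_contra hwp
    have hcons : (Walk.cons hadj.symm p).IsPath := (Walk.cons_isPath_iff _ _).2 ⟨hp, hwp⟩
    have hlt := length_lt_of_edgePath_free hfree hcons
    rw [Walk.length_cons] at hlt
    have hle : p.length + 1 ≤ Nat.findGreatest P k :=
      Nat.le_findGreatest hlt.le ⟨w, v, _, hcons, by simpa [hwS] using hpS, Walk.length_cons _ _⟩
    omega
  calc _ ≤ (p.support.toFinset.erase u).card := Finset.card_le_card hsub
    _ = p.length := by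
      rw [Finset.card_erase_of_mem (by simp), List.toFinset_card_of_nodup hp.support_nodup,
        Walk.length_support, Nat.add_sub_cancel]
    _ < k := length_lt_of_edgePath_free hfree hp

lemma card_interedges_self_le [DecidableRel G.Adj] (hfree : (edgePath k).Free G)
    (S : Finset V) : (G.interedges S S).card ≤ 2 * k * S.card := by
  classical
  induction S using Finset.strongInduction with
  | H S ih =>
    rcases S.eq_empty_or_nonempty with rfl | hS
    · simp [interedges]
    obtain ⟨v, hv, hdeg⟩ := exists_card_filter_adj_lt hfree hS
    set N := {w ∈ S | G.Adj v w}
    have hsub : G.interedges S S ⊆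
        G.interedges (S.erase v) (S.erase v) ∪ ({v} ×ˢ N ∪ N ×ˢ {v}) := by
      rintro ⟨x, y⟩ hxy
      obtain ⟨hx, hy, hadj⟩ := (G.mk_mem_interedges_iff).1 hxy
      by_cases hxv : x = v
      · subst hxv
        simp [N, hy, hadj]
      by_cases hyv : y = v
      · subst hyv
        simp [N, hx, hadj.symm]
      simp [mk_mem_interedges_iff, hx, hy, hxv, hyv, hadj]
    have hcard := Finset.card_erase_add_one hv
    calc (G.interedges S S).card ≤ _ := Finset.card_le_card hsub
      _ ≤ (G.interedges (S.erase v) (S.erase v)).card + (({v} ×ˢ N).card + (N ×ˢ {v}).card) :=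
        (Finset.card_union_le _ _).trans (Nat.add_le_add_left (Finset.card_union_le _ _) _)
      _ ≤ 2 * k * (S.erase v).card + (k + k) := by
        simp only [Finset.card_product, Finset.card_singleton, one_mul, mul_one]
        exact add_le_add (ih _ (Finset.erase_ssubset hv)) (add_le_add hdeg.le hdeg.le)
      _ = 2 * k * S.card := by
        rw [← hcard]
        ring

end PathFree

section ReplaceNeighbors

open SimpleGraph

variable {V : Type*} {G : SimpleGraph V} {k : ℕ} {A B D : Finset V}

/-- The graph obtained from `G` by deleting all edges at the vertices of `D` and then joining
every vertex of `D` to every vertex of `A \ D`. -/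
def replaceNeighbors (G : SimpleGraph V) (D A : Finset V) : SimpleGraph V where
  Adj u v := (u ∉ D ∧ v ∉ D ∧ G.Adj u v) ∨ (u ∈ D ∧ v ∈ A ∧ v ∉ D) ∨ (u ∈ A ∧ u ∉ D ∧ v ∈ D)
  symm := ⟨fun u v h => by rw [G.adj_comm]; tauto⟩
  loopless := ⟨fun u h => by have := G.irrefl (v := u); tauto⟩

lemma notMem_of_not_adj_replaceNeighbors (hDA : Disjoint D A) {u v : V} (hG : G.Adj u v)
    (h : ¬(replaceNeighbors G D A).Adj u v) : u ∉ A ∧ v ∉ A ∧ (u ∈ D ∨ v ∈ D) := by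
  have hu : u ∈ D → u ∉ A := fun h => Finset.disjoint_left.1 hDA h
  have hv : v ∈ D → v ∉ A := fun h => Finset.disjoint_left.1 hDA h
  simp only [replaceNeighbors] at h
  tauto

lemma replaceNeighbors_free (hfree : (edgePath k).Free G) (hAB : G.IsCompleteBetween A B)
    (hcard : 2 * (k + 1) ≤ B.card) : (edgePath k).Free (replaceNeighbors G D A) := by
  classical
  rintro ⟨f⟩
  obtain ⟨φ⟩ : Nonempty (Fin (k + 1) ↪ (B \ Finset.univ.image f : Finset V)) := by
    refine Function.Embedding.nonempty_of_card_le ?_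
    have himage : (Finset.univ.image f).card ≤ k + 1 := Finset.card_image_le.trans (by simp)
    have := Finset.le_card_sdiff (Finset.univ.image f) B
    simp only [Fintype.card_fin, Fintype.card_coe]
    omega
  have hφB (i) : (φ i : V) ∈ B := (Finset.mem_sdiff.1 (φ i).2).1
  have hφf (i j) : (φ i : V) ≠ f j := fun h =>
    (Finset.mem_sdiff.1 (φ i).2).2 (h ▸ Finset.mem_image_of_mem f (Finset.mem_univ j))
  -- Move the vertices of the path that lie in `D` to unused vertices of `B`.
  refine hfree ⟨⟨⟨fun i => if f i ∈ D then φ i else f i, ?_⟩, ?_⟩⟩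
  · intro i j hij
    have hadj : (replaceNeighbors G D A).Adj (f i) (f j) := f.toHom.map_adj hij
    change G.Adj (if f i ∈ D then φ i else f i) (if f j ∈ D then φ j else f j)
    rcases hadj with ⟨hi, hj, h⟩ | ⟨hi, hj, hj'⟩ | ⟨hi, hi', hj⟩
    · simpa only [hi, hj, if_false] using h
    · simpa [hi, hj'] using (hAB hj (hφB i)).symm
    · simpa [hi', hj] using hAB hi (hφB j)
  · intro i j hij
    change (if f i ∈ D then (φ i : V) else f i) = if f j ∈ D then (φ j : V) else f j at hij
    split_ifs at hij
    · exact φ.injective (Subtype.ext hij)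
    · exact absurd hij (hφf i j)
    · exact absurd hij.symm (hφf j i)
    · exact f.injective hij

lemma card_mul_le_card_pathTuples_replaceNeighbors_sdiff [Fintype V] [DecidableEq V]
    (hAB : G.IsCompleteBetween A B) (hA : 2 ≤ A.card) (hDA : Disjoint D A)
    (hD : ∀ v ∈ D, ∃ a ∈ A, ¬G.Adj a v) :
    (B.card * B.card - B.card) * D.card ≤
      (pathTuples (replaceNeighbors G D A) \ pathTuples G).card := by
  have hex (v : V) : ∃ a a', v ∈ D → a ∈ A ∧ ¬G.Adj a v ∧ a' ∈ A ∧ a' ≠ a := by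
    by_cases hv : v ∈ D
    · obtain ⟨a, ha, hav⟩ := hD v hv
      obtain ⟨a', ha', hne⟩ := Finset.exists_mem_ne hA a
      exact ⟨a, a', fun _ => ⟨ha, hav, ha', hne⟩⟩
    · exact ⟨v, v, fun h => absurd h hv⟩
  choose α β hαβ using hex
  rw [← Finset.offDiag_card, ← Finset.card_product]
  refine Finset.card_le_card_of_injOn (fun p => (p.1.1, β p.2, p.1.2, α p.2, p.2)) ?_ ?_
  · rintro ⟨⟨x, y⟩, v⟩ hp
    obtain ⟨⟨hx, hy, hxy⟩, hv⟩ : (x ∈ B ∧ y ∈ B ∧ x ≠ y) ∧ v ∈ D := by simpa using hp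
    obtain ⟨hα, hnot, hβ, hne⟩ := hαβ v hv
    have hAD {a : V} (ha : a ∈ A) : a ∉ D := Finset.disjoint_right.1 hDA ha
    have hBD {b : V} (hb : b ∈ B) : b ∉ D := fun h =>
      let ⟨_, ha, hab⟩ := hD b h
      hab (hAB ha hb)
    have hadj {a b : V} (ha : a ∈ A) (hb : b ∈ B) : (replaceNeighbors G D A).Adj a b :=
      Or.inl ⟨hAD ha, hBD hb, hAB ha hb⟩
    have hadj' : (replaceNeighbors G D A).Adj (α v) v := Or.inr (Or.inr ⟨hα, hAD hα, hv⟩)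
    refine Finset.mem_sdiff.2 ⟨mem_pathTuples.2
      ⟨⟨(hadj hβ hx).symm, hadj hβ hy, (hadj hα hy).symm, hadj'⟩, ?_⟩,
      fun h => hnot (mem_pathTuples.1 h).1.2.2.2⟩
    have hxv : x ≠ v := fun h => hBD hx (h ▸ hv)
    have hyv : y ≠ v := fun h => hBD hy (h ▸ hv)
    have hβv : β v ≠ v := fun h => hAD hβ (h.symm ▸ hv)
    simp [hxy, hne, hxv, hyv, hβv, (hadj hβ hx).ne', (hadj hβ hy).ne, (hadj hα hx).ne',
      (hadj hα hy).ne', hadj'.ne]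
  · rintro ⟨⟨x, y⟩, v⟩ - ⟨⟨x', y'⟩, v'⟩ - h
    simp only [Prod.mk.injEq] at h ⊢
    tauto

end ReplaceNeighbors

section OuterPaths

open SimpleGraph

variable {V : Type*} {G : SimpleGraph V} {k : ℕ} {A B : Finset V}

lemma eq_of_adj_adj_adj (hfree : (edgePath k).Free G) (hAB : G.IsCompleteBetween A B)
    (hk : k ≤ 2 * A.card + 2) (hcard : A.card + 3 ≤ B.card) {a w₁ w₂ w₃ : V} (ha : a ∈ A)
    (hw₁ : w₁ ∉ A) (hw₂ : w₂ ∉ A) (hw₃ : w₃ ∉ A) (h₁ : G.Adj a w₁) (h₂ : G.Adj w₁ w₂)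
    (h₃ : G.Adj w₂ w₃) : w₁ = w₃ := by
  by_contra hne
  let p : G.Walk w₃ a := .cons h₃.symm (.cons h₂.symm (.cons h₁.symm .nil))
  have hp : p.IsPath := by
    rw [Walk.isPath_def]
    simp [p, h₁.ne', h₂.ne', h₃.ne', Ne.symm hne,
      (ne_of_mem_of_not_mem ha hw₂).symm, (ne_of_mem_of_not_mem ha hw₃).symm]
  have hpA : ∀ x ∈ p.support, x ∈ A → x = a := by simp [p, hw₁, hw₂, hw₃]
  have := length_add_two_mul_card_le hfree hAB hp ha hpA hcard
  simp only [p, Walk.length_cons, Walk.length_nil] at this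
  omega

lemma notMem_union_of_adj_adj [DecidableEq V] (hfree : (edgePath k).Free G)
    (hAB : G.IsCompleteBetween A B) (hA : A.Nonempty) (hk : k ≤ 2 * A.card + 2)
    (hcard : A.card + 3 ≤ B.card) {x y z : V}
    (hxy : G.Adj x y) (hyz : G.Adj y z) (hxz : x ≠ z) (hx : x ∉ A) (hy : y ∉ A) (hz : z ∉ A) :
    x ∉ A ∪ B ∧ ∀ w, G.Adj x w → w ∉ A := by
  have hnot (w : V) (hw : w ∈ A) (hwx : G.Adj w x) : False :=
    hxz (eq_of_adj_adj_adj hfree hAB hk hcard hw hx hy hz hwx hxy hyz)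
  obtain ⟨w, hw⟩ := hA
  refine ⟨fun hxAB => ?_, fun w hxw hw => hnot w hw hxw.symm⟩
  exact hnot w hw (hAB hw ((Finset.mem_union.1 hxAB).resolve_left hx))

open Classical in
/-- The edges of `G`, as ordered pairs, that avoid `A` and have an end outside `A ∪ B`. -/
noncomputable def strayPairs [Fintype V] (G : SimpleGraph V) (A B : Finset V) : Finset (V × V) :=
  {p | G.Adj p.1 p.2 ∧ p.1 ∉ A ∧ p.2 ∉ A ∧ (p.1 ∉ A ∪ B ∨ p.2 ∉ A ∪ B)}

variable [Fintype V] [DecidableEq V]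

lemma mem_strayPairs {u v : V} : (u, v) ∈ strayPairs G A B ↔
    G.Adj u v ∧ u ∉ A ∧ v ∉ A ∧ (u ∉ A ∪ B ∨ v ∉ A ∪ B) := by
  simp [strayPairs]

lemma card_interedges_compl_union_le [DecidableRel G.Adj] (hfree : (edgePath k).Free G)
    (hAB : G.IsCompleteBetween A B) (hA : A.Nonempty) (hk : k ≤ 2 * A.card + 2)
    (hcard : A.card + 3 ≤ B.card) :
    (G.interedges (A ∪ B)ᶜ B).card ≤ (A ∪ B)ᶜ.card := by
  obtain ⟨a, ha⟩ := hA
  refine Finset.card_le_card_of_injOn Prod.fst (fun p hp => (mem_interedges_iff _ |>.1 hp).1) ?_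
  rintro ⟨u, b⟩ hb ⟨u', b'⟩ hb' (rfl : u = u')
  obtain ⟨hu, hb, hub⟩ := G.mk_mem_interedges_iff.1 hb
  obtain ⟨-, hb', hub'⟩ := G.mk_mem_interedges_iff.1 hb'
  have hBA {b : V} (hb : b ∈ B) : b ∉ A := fun h => Set.disjoint_left.1 hAB.disjoint h hb
  have huA : u ∉ A := fun h => Finset.mem_compl.1 hu (Finset.mem_union_left _ h)
  rw [eq_of_adj_adj_adj hfree hAB hk hcard ha (hBA hb) huA (hBA hb') (hAB ha hb) hub.symm hub']

lemma card_strayPairs_le (hfree : (edgePath k).Free G) (hAB : G.IsCompleteBetween A B)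
    (hA : A.Nonempty) (hk : k ≤ 2 * A.card + 2) (hcard : A.card + 3 ≤ B.card) :
    (strayPairs G A B).card ≤ 2 * (k + 1) * (A ∪ B)ᶜ.card := by
  classical
  set R := (A ∪ B)ᶜ with hR
  have hsub : strayPairs G A B ⊆
      G.interedges R R ∪ (G.interedges R B ∪ G.interedges B R) := by
    rintro ⟨u, v⟩ h
    rw [mem_strayPairs] at h
    simp only [Finset.mem_union, mk_mem_interedges_iff, hR, Finset.mem_compl] at h ⊢
    tauto
  have hcomm : (G.interedges B R).card = (G.interedges R B).card :=
    haveI := G.symm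
    Rel.card_interedges_comm _ _
  have hRB := card_interedges_compl_union_le hfree hAB hA hk hcard
  have hRR := card_interedges_self_le hfree R
  have hunion := Finset.card_union_le (G.interedges R R) (G.interedges R B ∪ G.interedges B R)
  have hunion' := Finset.card_union_le (G.interedges R B) (G.interedges B R)
  have := Finset.card_le_card hsub
  nlinarith

lemma forall_notMem_union_of_mem_pathTuples (hfree : (edgePath k).Free G)
    (hAB : G.IsCompleteBetween A B) (hA : A.Nonempty) (hk : k ≤ 2 * A.card + 2)
    (hcard : A.card + 3 ≤ B.card) {a b c d e : V} (h : (a, b, c, d, e) ∈ pathTuples G)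
    (ha : a ∉ A) (hb : b ∉ A) (hc : c ∉ A) : ∀ x ∈ [a, b, c, d, e], x ∉ A ∪ B := by
  obtain ⟨⟨hab, hbc, hcd, hde⟩, hnodup⟩ := mem_pathTuples.1 h
  simp only [List.nodup_cons, List.mem_cons, not_or] at hnodup
  obtain ⟨⟨-, hac, -⟩, ⟨-, hbd, -⟩, ⟨-, hce, -⟩, -⟩ := hnodup
  have houter {x y z : V} (hxy : G.Adj x y) (hyz : G.Adj y z) (hxz : x ≠ z) (hx : x ∉ A)
      (hy : y ∉ A) (hz : z ∉ A) :=
    notMem_union_of_adj_adj hfree hAB hA hk hcard hxy hyz hxz hx hy hz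
  have hC := houter hbc.symm hab.symm (Ne.symm hac) hc hb ha
  have hd := hC.2 d hcd
  have hD := houter hcd.symm hbc.symm (Ne.symm hbd) hd hc hb
  have he := hD.2 e hde
  rw [List.forall_mem_cons, List.forall_mem_cons, List.forall_mem_cons, List.forall_mem_cons,
    List.forall_mem_singleton]
  exact ⟨(houter hab hbc hac ha hb hc).1, (houter hbc hcd hbd hb hc hd).1, hC.1, hD.1,
    (houter hde.symm hcd.symm (Ne.symm hce) he hd hc).1⟩

lemma exists_strayPairs_of_mem_sdiff {x : V × V × V × V × V}
    (hx : x ∈ pathTuples G \ pathTuples (replaceNeighbors G (A ∪ B)ᶜ A)) :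
    (x.1, x.2.1) ∈ strayPairs G A B ∨ (x.2.1, x.2.2.1) ∈ strayPairs G A B ∨
      (x.2.2.1, x.2.2.2.1) ∈ strayPairs G A B ∨ (x.2.2.2.1, x.2.2.2.2) ∈ strayPairs G A B := by
  obtain ⟨hG, hG'⟩ := Finset.mem_sdiff.1 hx
  obtain ⟨⟨hab, hbc, hcd, hde⟩, hnodup⟩ := mem_pathTuples.1 hG
  have hdisj : Disjoint (A ∪ B)ᶜ A :=
    Finset.disjoint_left.2 fun x hx hxA => Finset.mem_compl.1 hx (Finset.mem_union_left _ hxA)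
  have hkept {u v : V} (huv : G.Adj u v) (hnot : (u, v) ∉ strayPairs G A B) :
      (replaceNeighbors G (A ∪ B)ᶜ A).Adj u v := by
    by_contra h
    have := notMem_of_not_adj_replaceNeighbors hdisj huv h
    exact hnot (mem_strayPairs.2 ⟨huv, by simpa using this⟩)
  by_contra! hnot
  exact hG' (mem_pathTuples.2 ⟨⟨hkept hab hnot.1, hkept hbc hnot.2.1, hkept hcd hnot.2.2.1,
    hkept hde hnot.2.2.2⟩, hnodup⟩)

lemma forall_notMem_or_strayPairs_of_mem_sdiff (hfree : (edgePath k).Free G)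
    (hAB : G.IsCompleteBetween A B) (hA : A.Nonempty) (hk : k ≤ 2 * A.card + 2)
    (hcard : A.card + 3 ≤ B.card) {a b c d e : V}
    (h : (a, b, c, d, e) ∈ pathTuples G \ pathTuples (replaceNeighbors G (A ∪ B)ᶜ A)) :
    (∀ x ∈ [a, b, c, d, e], x ∉ A ∪ B) ∨ (a, b) ∈ strayPairs G A B ∧ c ∈ A ∨
      (b, c) ∈ strayPairs G A B ∧ a ∈ A ∨ (c, d) ∈ strayPairs G A B ∧ e ∈ A ∨
      (d, e) ∈ strayPairs G A B ∧ c ∈ A := by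
  have hright := forall_notMem_union_of_mem_pathTuples hfree hAB hA hk hcard
    (Finset.mem_sdiff.1 h).1
  have hleft := forall_notMem_union_of_mem_pathTuples hfree hAB hA hk hcard
    (mem_pathTuples_reverse (Finset.mem_sdiff.1 h).1)
  replace hleft (he : e ∉ A) (hd : d ∉ A) (hc : c ∉ A) : ∀ x ∈ [a, b, c, d, e], x ∉ A ∪ B :=
    fun x hx => hleft he hd hc x (by simpa using (List.mem_reverse.2 hx))
  rcases exists_strayPairs_of_mem_sdiff h with h | h | h | h <;>
    obtain ⟨-, hu, hv, -⟩ := mem_strayPairs.1 h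
  · by_cases hc : c ∈ A
    exacts [.inr (.inl ⟨h, hc⟩), .inl (hright hu hv hc)]
  · by_cases ha : a ∈ A
    exacts [.inr (.inr (.inl ⟨h, ha⟩)), .inl (hright ha hu hv)]
  · by_cases he : e ∈ A
    exacts [.inr (.inr (.inr (.inl ⟨h, he⟩))), .inl (hleft he hv hu)]
  · by_cases hc : c ∈ A
    exacts [.inr (.inr (.inr (.inr ⟨h, hc⟩))), .inl (hleft hv hu hc)]

end OuterPaths

section LostPaths

open SimpleGraph

variable {V : Type*} [Fintype V] [DecidableEq V] {G : SimpleGraph V} {k : ℕ} {A B : Finset V}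

lemma card_pathTuples_sdiff_replaceNeighbors_le_add [DecidableRel G.Adj]
    (hfree : (edgePath k).Free G) (hAB : G.IsCompleteBetween A B) (hA : A.Nonempty)
    (hk : k ≤ 2 * A.card + 2) (hcard : A.card + 3 ≤ B.card) :
    (pathTuples G \ pathTuples (replaceNeighbors G (A ∪ B)ᶜ A)).card ≤
      (G.interedges (A ∪ B)ᶜ (A ∪ B)ᶜ).card ^ 2 * (A ∪ B)ᶜ.card +
        4 * ((strayPairs G A B).card * A.card * (G.interedges .univ .univ).card) := by
  set R := (A ∪ B)ᶜ
  set S := strayPairs G A B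
  set E := G.interedges .univ .univ
  let f (x : (V × V) × V × V × V) : V × V × V × V × V := (x.1.1, x.1.2, x.2)
  let g (x : (V × V) × V × V × V) : V × V × V × V × V := (x.2.1, x.1.1, x.1.2, x.2.2)
  let h (x : (V × V) × (V × V) × V) : V × V × V × V × V :=
    (x.1.1, x.1.2, x.2.1.1, x.2.1.2, x.2.2)
  have hsub : pathTuples G \ pathTuples (replaceNeighbors G R A) ⊆
      (G.interedges R R ×ˢ R ×ˢ G.interedges R R).image f ∪ (S ×ˢ A ×ˢ E).image f ∪
        (S ×ˢ A ×ˢ E).image g ∪ (E ×ˢ S ×ˢ A).image h ∪ (E ×ˢ A ×ˢ S).image f := by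
    rintro ⟨a, b, c, d, e⟩ hx
    obtain ⟨⟨hab, -, -, hde⟩, -⟩ := mem_pathTuples.1 (Finset.mem_sdiff.1 hx).1
    simp only [Finset.mem_union, or_assoc]
    rcases forall_notMem_or_strayPairs_of_mem_sdiff hfree hAB hA hk hcard hx with
      hall | ⟨hS, hc⟩ | ⟨hS, ha⟩ | ⟨hS, he⟩ | ⟨hS, hc⟩
    · have hmem (x : V) (hx : x ∈ [a, b, c, d, e]) : x ∈ R := Finset.mem_compl.2 (hall x hx)
      refine .inl (Finset.mem_image.2 ⟨((a, b), c, d, e), ?_, rfl⟩)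
      simp [mk_mem_interedges_iff, hab, hde, hmem]
    · refine .inr (.inl (Finset.mem_image.2 ⟨((a, b), c, d, e), ?_, rfl⟩))
      simp [E, S, hS, hc, hde, mk_mem_interedges_iff]
    · refine .inr (.inr (.inl (Finset.mem_image.2 ⟨((b, c), a, d, e), ?_, rfl⟩)))
      simp [E, S, hS, ha, hde, mk_mem_interedges_iff]
    · refine .inr (.inr (.inr (.inl (Finset.mem_image.2 ⟨((a, b), (c, d), e), ?_, rfl⟩))))
      simp [E, S, hS, he, hab, mk_mem_interedges_iff]
    · refine .inr (.inr (.inr (.inr (Finset.mem_image.2 ⟨((a, b), c, d, e), ?_, rfl⟩))))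
      simp [E, S, hS, hc, hab, mk_mem_interedges_iff]
  calc _ ≤ _ := Finset.card_le_card hsub
    _ ≤ (G.interedges R R ×ˢ R ×ˢ G.interedges R R).card + (S ×ˢ A ×ˢ E).card +
        (S ×ˢ A ×ˢ E).card + (E ×ˢ S ×ˢ A).card + (E ×ˢ A ×ˢ S).card := by
      iterate 4
        refine (Finset.card_union_le _ _).trans (add_le_add ?_ Finset.card_image_le)
      exact Finset.card_image_le
    _ = _ := by
      simp only [Finset.card_product]
      ring

lemma card_pathTuples_sdiff_replaceNeighbors_le (hfree : (edgePath k).Free G)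
    (hAB : G.IsCompleteBetween A B) (hA : A.Nonempty) (hk : k ≤ 2 * A.card + 2)
    (hcard : A.card + 3 ≤ B.card) :
    (pathTuples G \ pathTuples (replaceNeighbors G (A ∪ B)ᶜ A)).card ≤
      ((2 * k * (A ∪ B)ᶜ.card) ^ 2 + 16 * k * (k + 1) * A.card * Fintype.card V) *
        (A ∪ B)ᶜ.card := by
  classical
  calc _ ≤ _ := card_pathTuples_sdiff_replaceNeighbors_le_add hfree hAB hA hk hcard
    _ ≤ (2 * k * (A ∪ B)ᶜ.card) ^ 2 * (A ∪ B)ᶜ.card +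
        4 * (2 * (k + 1) * (A ∪ B)ᶜ.card * A.card * (2 * k * Fintype.card V)) := by
      gcongr
      · exact card_interedges_self_le hfree _
      · exact card_strayPairs_le hfree hAB hA hk hcard
      · exact card_interedges_self_le hfree _
    _ = _ := by ring

lemma union_eq_univ_of_isPathExtremal (hG : IsPathExtremal k G) (hAB : G.IsCompleteBetween A B)
    (hcommon : ∀ v, (∀ a ∈ A, G.Adj a v) → v ∈ B) (hA : 2 ≤ A.card) (hk : k ≤ 2 * A.card + 2)
    (hcard : 2 * (k + 1) ≤ B.card) (hcard' : A.card + 3 ≤ B.card)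
    (hlarge : (2 * k * (A ∪ B)ᶜ.card) ^ 2 + 16 * k * (k + 1) * A.card * Fintype.card V <
      B.card * B.card - B.card) : A ∪ B = .univ := by
  rw [← Finset.compl_eq_empty_iff]
  by_contra hne
  have hpos : 0 < (A ∪ B)ᶜ.card := Finset.card_pos.2 (Finset.nonempty_iff_ne_empty.2 hne)
  have hnotMem {v : V} (hv : v ∈ (A ∪ B)ᶜ) : v ∉ A ∧ v ∉ B := by simpa using hv
  have hgain := card_mul_le_card_pathTuples_replaceNeighbors_sdiff hAB hA
    (Finset.disjoint_left.2 fun v hv => (hnotMem hv).1) fun v hv => by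
      by_contra! h
      exact (hnotMem hv).2 (hcommon v h)
  have hloss := card_pathTuples_sdiff_replaceNeighbors_le hG.1 hAB
    (Finset.card_pos.1 (by omega)) hk hcard'
  have hmax := hG.2 _ (replaceNeighbors_free (D := (A ∪ B)ᶜ) hG.1 hAB hcard)
  rw [← Finset.card_sdiff_le_card_sdiff_iff] at hmax
  exact absurd ((hgain.trans hmax).trans hloss)
    (not_le.2 (Nat.mul_lt_mul_of_pos_right hlarge hpos))

end LostPaths

section CompleteCore

open SimpleGraph

variable {V : Type*} {G : SimpleGraph V} {k : ℕ} {A B : Finset V}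

lemma card_le_card_of_isCompleteBetween (hfree : (edgePath k).Free G)
    (hAB : G.IsCompleteBetween A B) (hA : A.Nonempty) (hk : k ≤ 2 * A.card) :
    B.card ≤ A.card := by
  by_contra! hlt
  obtain ⟨a, ha⟩ := hA
  obtain ⟨b, hb⟩ := Finset.card_pos.1 ((Nat.zero_le _).trans_lt hlt)
  have hba := (hAB ha hb).symm
  have hbA : b ∉ A := fun h => Set.disjoint_left.1 hAB.disjoint h hb
  have := length_add_two_mul_card_le (p := hba.toWalk) hfree hAB (Walk.IsPath.of_adj hba) ha
    (by simp [hbA]) (by simpa using hlt)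
  simp only [Walk.length_cons, Walk.length_nil] at this
  omega

lemma add_two_le_of_adj_of_notMem (hfree : (edgePath k).Free G) (hAB : G.IsCompleteBetween A B)
    (hA : A.Nonempty) (hcard : A.card + 2 ≤ B.card) {x y : V} (hxy : G.Adj x y) (hx : x ∈ B)
    (hy : y ∉ A) : 2 * A.card + 2 ≤ k := by
  obtain ⟨a, ha⟩ := hA
  have hax := hAB ha hx
  have hxA : x ∉ A := fun h => Set.disjoint_left.1 hAB.disjoint h hx
  let p : G.Walk y a := .cons hxy.symm (.cons hax.symm .nil)
  have hp : p.IsPath := by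
    rw [Walk.isPath_def]
    simp [p, hxy.ne', hax.ne', (ne_of_mem_of_not_mem ha hy).symm]
  have := length_add_two_mul_card_le hfree hAB hp ha (by simp [p, hxA, hy])
    (by simpa [p] using hcard)
  simp only [p, Walk.length_cons, Walk.length_nil] at this
  omega

variable [Fintype V] [DecidableEq V]

lemma not_adj_of_disjoint_edge (hfree : (edgePath k).Free G) (hA : G.IsCompleteBetween A ↑Aᶜ)
    (hcard : 2 ≤ A.card) (hk : k ≤ 2 * A.card + 2) (hcompl : A.card + 4 ≤ Aᶜ.card) {x y z w : V}
    (hxy : G.Adj x y) (hx : x ∉ A) (hy : y ∉ A) (hz : z ∉ A) (hw : w ∉ A)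
    (hnodup : [x, y, z, w].Nodup) : ¬G.Adj z w := by
  intro hzw
  obtain ⟨a, ha, a', ha', hne⟩ := Finset.one_lt_card.1 hcard
  have hadj {a v : V} (ha : a ∈ A) (hv : v ∉ A) : G.Adj a v := hA ha (by simpa using hv)
  -- Both edges are attached to `a'`, which leaves `A.erase a'` for the rest of the path.
  let p : G.Walk w a := .cons hzw.symm (.cons (hadj ha' hz).symm (.cons (hadj ha' hy)
    (.cons hxy.symm (.cons (hadj ha hx).symm .nil))))
  have hp : p.IsPath := by
    have hmem {a v : V} (ha : a ∈ A) (hv : v ∉ A) : a ≠ v := ne_of_mem_of_not_mem ha hv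
    have hperm : [a, a', x, y, z, w].Nodup := List.nodup_cons.2
      ⟨by simp [hne, hmem ha hx, hmem ha hy, hmem ha hz, hmem ha hw], List.nodup_cons.2
        ⟨by simp [hmem ha' hx, hmem ha' hy, hmem ha' hz, hmem ha' hw], hnodup⟩⟩
    rw [Walk.isPath_def, show p.support = [w, z, a', y, x, a] from rfl]
    refine (List.Perm.nodup_iff ?_).1 hperm
    grind
  have herase : G.IsCompleteBetween ↑(A.erase a') ↑Aᶜ := fun b hb => hA (Finset.mem_of_mem_erase hb)
  have := length_add_two_mul_card_le hfree herase hp (Finset.mem_erase.2 ⟨hne, ha⟩)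
    (by simp [p, hx, hy, hz, hw]) (by
      rw [Finset.card_erase_of_mem ha']
      simp only [p, Walk.length_cons, Walk.length_nil]
      omega)
  rw [Finset.card_erase_of_mem ha'] at this
  simp only [p, Walk.length_cons, Walk.length_nil] at this
  omega

lemma outer_edge_unique (hfree : (edgePath k).Free G) (hA : G.IsCompleteBetween A ↑Aᶜ)
    (hcard : 2 ≤ A.card) (hk : k ≤ 2 * A.card + 2) (hcompl : A.card + 4 ≤ Aᶜ.card) {x y z w : V}
    (hxy : G.Adj x y) (hzw : G.Adj z w) (hx : x ∉ A) (hy : y ∉ A) (hz : z ∉ A) (hw : w ∉ A) :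
    s(x, y) = s(z, w) := by
  obtain ⟨a, ha⟩ := Finset.card_pos.1 (by omega : 0 < A.card)
  have hend {w₁ w₂ w₃ : V} (h₁ : w₁ ∉ A) (h₂ : w₂ ∉ A) (h₃ : w₃ ∉ A) (h₁₂ : G.Adj w₁ w₂)
      (h₂₃ : G.Adj w₂ w₃) : w₁ = w₃ :=
    eq_of_adj_adj_adj hfree hA hk (by omega) ha h₁ h₂ h₃ (hA ha (by simpa using h₁)) h₁₂ h₂₃
  by_cases hnodup : [x, y, z, w].Nodup
  · exact absurd hzw (not_adj_of_disjoint_edge hfree hA hcard hk hcompl hxy hx hy hz hw hnodup)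
  have hshared : x = z ∨ x = w ∨ y = z ∨ y = w := by
    have := hxy.ne
    have := hzw.ne
    simp only [List.nodup_cons, List.mem_cons, List.not_mem_nil, List.nodup_nil] at hnodup
    tauto
  rcases hshared with rfl | rfl | rfl | rfl
  · rw [hend hy hx hw hxy.symm hzw]
  · rw [hend hy hx hz hxy.symm hzw.symm, Sym2.eq_swap]
  · rw [hend hx hy hw hxy hzw, Sym2.eq_swap]
  · rw [hend hx hy hz hxy hzw.symm]

lemma exists_finset_forall_adj (hfree : (edgePath k).Free G) (hA : G.IsCompleteBetween A ↑Aᶜ)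
    (hcard : 2 ≤ A.card) (hk : k ≤ 2 * A.card + 2) (hcompl : A.card + 4 ≤ Aᶜ.card) :
    ∃ C : Finset V, Disjoint A C ∧ C.card ≤ k - 2 * A.card ∧
      ∀ u v, G.Adj u v → u ∈ A ∨ v ∈ A ∨ u ∈ C ∧ v ∈ C := by
  by_cases houter : ∃ x y, G.Adj x y ∧ x ∉ A ∧ y ∉ A
  · obtain ⟨x, y, hxy, hx, hy⟩ := houter
    refine ⟨{x, y}, by simp [hx, hy], ?_, fun u v huv => ?_⟩
    · rw [Finset.card_pair hxy.ne]
      have := add_two_le_of_adj_of_notMem hfree hA (Finset.card_pos.1 (by omega)) (by omega) hxy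
        (by simpa using hx) hy
      omega
    · by_contra! hnot
      have := outer_edge_unique hfree hA hcard hk hcompl hxy huv hx hy hnot.1 hnot.2.1
      have := hnot.2.2
      grind
  · push Not at houter
    refine ⟨∅, by simp, by simp, fun u v huv => ?_⟩
    have := houter u v huv
    tauto

end CompleteCore

section CountingByDegrees

open SimpleGraph

variable {V : Type*} [Fintype V] {G : SimpleGraph V} [DecidableRel G.Adj] {k Δ : ℕ}

lemma card_filter_pathTuples_second_le [DecidableEq V] (hfree : (edgePath k).Free G) {L : Finset V}
    (hL : ∀ v ∈ L, G.degree v ≤ Δ) :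
    {x ∈ pathTuples G | x.2.1 ∈ L}.card ≤ Δ * (2 * k * Fintype.card V) ^ 2 := by
  let D := G.interedges .univ .univ
  have hD : D.card ≤ 2 * k * Fintype.card V := card_interedges_self_le hfree .univ
  calc {x ∈ pathTuples G | x.2.1 ∈ L}.card
      ≤ Δ * (D ×ˢ D).card := by
        refine Finset.card_le_mul_card_image_of_maps_to
          (f := fun x => ((x.2.1, x.2.2.1), x.2.2.2.1, x.2.2.2.2)) ?_ _ ?_
        · rintro ⟨a, b, c, d, e⟩ hx
          obtain ⟨⟨-, hbc, -, hde⟩, -⟩ := mem_pathTuples.1 (Finset.mem_filter.1 hx).1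
          simp [D, mk_mem_interedges_iff, hbc, hde]
        · rintro ⟨⟨b, c⟩, d, e⟩ -
          by_cases hb : b ∈ L
          · refine le_trans ?_ (hL b hb)
            refine Finset.card_le_card_of_injOn Prod.fst ?_ ?_
            · rintro ⟨a, b', c', d', e'⟩ hx
              simp only [Finset.coe_filter, Set.mem_ofPred_eq, Finset.mem_filter, Prod.mk.injEq,
                mem_pathTuples] at hx
              obtain ⟨⟨⟨⟨hab, -⟩, -⟩, -⟩, ⟨rfl, -⟩, -⟩ := hx
              simpa using hab.symm
            · rintro ⟨a, b₁, c₁, d₁, e₁⟩ h₁ ⟨a', b₂, c₂, d₂, e₂⟩ h₂ h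
              simp_all
          · rw [Finset.filter_eq_empty_iff.2, Finset.card_empty]
            · exact Nat.zero_le _
            · rintro x hx h
              simp only [Prod.mk.injEq] at h
              exact hb (h.1.1 ▸ (Finset.mem_filter.1 hx).2)
    _ ≤ Δ * (2 * k * Fintype.card V) ^ 2 := by
        rw [Finset.card_product, ← sq]
        gcongr

lemma card_filter_pathTuples_fourth_le [DecidableEq V] (hfree : (edgePath k).Free G) {L : Finset V}
    (hL : ∀ v ∈ L, G.degree v ≤ Δ) :
    {x ∈ pathTuples G | x.2.2.2.1 ∈ L}.card ≤ Δ * (2 * k * Fintype.card V) ^ 2 := by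
  refine le_trans ?_ (card_filter_pathTuples_second_le hfree hL)
  refine Finset.card_le_card_of_injOn (fun x => (x.2.2.2.2, x.2.2.2.1, x.2.2.1, x.2.1, x.1)) ?_ ?_
  · rintro ⟨a, b, c, d, e⟩ hx
    obtain ⟨hx, hd⟩ := Finset.mem_filter.1 hx
    exact Finset.mem_coe.2 (Finset.mem_filter.2 ⟨mem_pathTuples_reverse hx, hd⟩)
  · rintro ⟨a, b, c, d, e⟩ - ⟨a', b', c', d', e'⟩ - h
    simp_all

lemma card_filter_pathTuples_mem_le [DecidableEq V] (H : Finset V) :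
    {x ∈ pathTuples G | x.2.1 ∈ H ∧ x.2.2.2.1 ∈ H}.card ≤
      ∑ c, ∑ p ∈ {b ∈ H | G.Adj b c}.offDiag, G.degree p.1 * G.degree p.2 := by
  rw [← Finset.sum_sigma Finset.univ (fun c => {b ∈ H | G.Adj b c}.offDiag)
    (fun y : Σ _ : V, V × V => G.degree y.2.1 * G.degree y.2.2),
    Finset.card_eq_sum_card_fiberwise (f := fun x => (⟨x.2.2.1, x.2.1, x.2.2.2.1⟩ : Σ _ : V, V × V))
      (t := Finset.univ.sigma fun c => {b ∈ H | G.Adj b c}.offDiag)]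
  · refine Finset.sum_le_sum ?_
    rintro ⟨c, b, d⟩ -
    rw [← card_neighborFinset_eq_degree, ← card_neighborFinset_eq_degree, ← Finset.card_product]
    refine Finset.card_le_card_of_injOn (fun x => (x.1, x.2.2.2.2)) ?_ ?_
    · rintro ⟨a, b', c', d', e⟩ hx
      simp only [Finset.coe_filter, Set.mem_ofPred_eq, Finset.mem_filter, Sigma.mk.injEq,
        heq_eq_eq, Prod.mk.injEq, mem_pathTuples] at hx
      obtain ⟨⟨⟨⟨hab, -, -, hde⟩, -⟩, -⟩, -, rfl, rfl⟩ := hx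
      simp [hab.symm, hde]
    · rintro ⟨a, b₁, c₁, d₁, e₁⟩ h₁ ⟨a', b₂, c₂, d₂, e₂⟩ h₂ h
      simp_all
  · rintro ⟨a, b, c, d, e⟩ hx
    obtain ⟨hx, hb, hd⟩ := Finset.mem_filter.1 hx
    obtain ⟨⟨-, hbc, hcd, -⟩, hnodup⟩ := mem_pathTuples.1 hx
    have hbd : b ≠ d := by
      rintro rfl
      simp at hnodup
    exact Finset.mem_coe.2 (Finset.mem_sigma.2 ⟨Finset.mem_univ _, Finset.mem_offDiag.2
      ⟨Finset.mem_filter.2 ⟨hb, hbc⟩, Finset.mem_filter.2 ⟨hd, hcd.symm⟩, hbd⟩⟩)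

lemma card_pathTuples_le_sum_degree_mul (hfree : (edgePath k).Free G) {H : Finset V}
    (hH : ∀ v ∉ H, G.degree v ≤ Δ) :
    (pathTuples G).card ≤
      (∑ c, ∑ p ∈ {b ∈ H | G.Adj b c}.offDiag, G.degree p.1 * G.degree p.2) +
        2 * Δ * (2 * k * Fintype.card V) ^ 2 := by
  classical
  have hL (v : V) (hv : v ∈ Hᶜ) : G.degree v ≤ Δ := hH v (Finset.mem_compl.1 hv)
  have hcover : pathTuples G ⊆ {x ∈ pathTuples G | x.2.1 ∈ H ∧ x.2.2.2.1 ∈ H} ∪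
      ({x ∈ pathTuples G | x.2.1 ∈ Hᶜ} ∪ {x ∈ pathTuples G | x.2.2.2.1 ∈ Hᶜ}) := fun x hx => by
    simp only [Finset.mem_union, Finset.mem_filter, hx, true_and, Finset.mem_compl]
    tauto
  have h := (Finset.card_le_card hcover).trans <|
    (Finset.card_union_le _ _).trans (Nat.add_le_add_left (Finset.card_union_le _ _) _)
  have hmem := card_filter_pathTuples_mem_le (G := G) H
  have hsecond := card_filter_pathTuples_second_le hfree hL
  have hfourth := card_filter_pathTuples_fourth_le hfree hL
  linarith

end CountingByDegrees

section DeficientSums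

variable {V : Type*} {S : Finset V} {w : V → ℕ} {n : ℕ}

lemma sum_offDiag_mul_le (hw : ∀ v ∈ S, w v ≤ n) :
    ∑ p ∈ S.offDiag, w p.1 * w p.2 ≤ S.card * (S.card - 1) * n ^ 2 := by
  have hterm (p : V × V) (hp : p ∈ S.offDiag) : w p.1 * w p.2 ≤ n ^ 2 := by
    rw [Finset.mem_offDiag] at hp
    rw [sq]
    exact Nat.mul_le_mul (hw _ hp.1) (hw _ hp.2.1)
  refine (Finset.sum_le_card_nsmul _ _ _ hterm).trans_eq ?_
  rw [Finset.offDiag_card, smul_eq_mul, Nat.mul_sub_one]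

lemma mul_sum_offDiag_mul_add_le {q : ℕ} (hw : ∀ v ∈ S, w v ≤ n) {v : V} (hv : v ∈ S)
    (hcard : 2 ≤ S.card) (hlow : q * w v + n ≤ q * n) :
    q * ∑ p ∈ S.offDiag, w p.1 * w p.2 + n ^ 2 ≤ q * (S.card * (S.card - 1) * n ^ 2) := by
  classical
  obtain ⟨u, hu, huv⟩ := Finset.exists_mem_ne hcard v
  have hmem : (v, u) ∈ S.offDiag := Finset.mem_offDiag.2 ⟨hv, hu, huv.symm⟩
  have hrest : ∑ p ∈ S.offDiag.erase (v, u), w p.1 * w p.2 ≤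
      (S.card * (S.card - 1) - 1) * n ^ 2 := by
    have hterm (p : V × V) (hp : p ∈ S.offDiag.erase (v, u)) : w p.1 * w p.2 ≤ n ^ 2 := by
      have hp' := Finset.mem_offDiag.1 (Finset.mem_of_mem_erase hp)
      rw [sq]
      exact Nat.mul_le_mul (hw _ hp'.1) (hw _ hp'.2.1)
    refine (Finset.sum_le_card_nsmul _ _ _ hterm).trans_eq ?_
    rw [Finset.card_erase_of_mem hmem, Finset.offDiag_card, smul_eq_mul, Nat.mul_sub_one]
  have hpos : 1 ≤ S.card * (S.card - 1) := Nat.mul_pos (by omega) (by omega)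
  have hterm : q * (w v * w u) + n ^ 2 ≤ q * n ^ 2 :=
    calc q * (w v * w u) + n ^ 2 ≤ q * (w v * n) + n ^ 2 := by gcongr; exact hw u hu
      _ = (q * w v + n) * n := by ring
      _ ≤ (q * n) * n := by gcongr
      _ = q * n ^ 2 := by ring
  rw [← Finset.add_sum_erase _ _ hmem]
  calc _ = (q * (w v * w u) + n ^ 2) +
        q * ∑ p ∈ S.offDiag.erase (v, u), w p.1 * w p.2 := by ring
    _ ≤ q * n ^ 2 + q * ((S.card * (S.card - 1) - 1) * n ^ 2) := by gcongr
    _ = q * ((1 + (S.card * (S.card - 1) - 1)) * n ^ 2) := by ring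
    _ = q * (S.card * (S.card - 1) * n ^ 2) := by rw [Nat.add_sub_cancel' hpos]

lemma card_eq_and_forall_lt_of_lt_mul_sum_offDiag {q t : ℕ} (hw : ∀ v ∈ S, w v ≤ n) (hq : 0 < q)
    (ht : 2 ≤ t) (hcard : S.card ≤ t)
    (h : q * (t * (t - 1) * n ^ 2) < q * ∑ p ∈ S.offDiag, w p.1 * w p.2 + n ^ 2) :
    S.card = t ∧ ∀ v ∈ S, q * n < q * w v + n := by
  have hcard_eq : S.card = t := by
    by_contra hne
    have hmul : S.card * (S.card - 1) + 1 ≤ t * (t - 1) := by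
      obtain ⟨t, rfl⟩ := Nat.exists_eq_add_of_le ht
      have : S.card * (S.card - 1) ≤ (1 + t) * t := Nat.mul_le_mul (by omega) (by omega)
      rw [show 2 + t - 1 = 1 + t by omega]
      linarith
    refine h.not_ge ?_
    calc q * ∑ p ∈ S.offDiag, w p.1 * w p.2 + n ^ 2
        ≤ q * (S.card * (S.card - 1) * n ^ 2) + q * n ^ 2 := by
          gcongr
          · exact sum_offDiag_mul_le hw
          · exact Nat.le_mul_of_pos_left _ hq
      _ = q * ((S.card * (S.card - 1) + 1) * n ^ 2) := by ring
      _ ≤ q * (t * (t - 1) * n ^ 2) := by gcongr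
  refine ⟨hcard_eq, fun v hv => ?_⟩
  by_contra! hlow
  have := mul_sum_offDiag_mul_add_le hw hv (hcard_eq ▸ ht) hlow
  rw [hcard_eq] at this
  omega

end DeficientSums

section Stability

open SimpleGraph

variable {V : Type*} [Fintype V] {G : SimpleGraph V} [DecidableRel G.Adj]
  {k t q : ℕ}

lemma sum_degree_le (hfree : (edgePath k).Free G) :
    ∑ v, G.degree v ≤ 2 * k * Fintype.card V := by
  refine le_trans (le_of_eq ?_) (card_interedges_self_le hfree .univ)
  rw [interedges, Rel.interedges, Finset.card_filter, Finset.sum_product]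
  refine Finset.sum_congr rfl fun v _ => ?_
  rw [← card_neighborFinset_eq_degree, neighborFinset_eq_filter, Finset.card_filter]

lemma card_filter_div_lt_degree_le (hfree : (edgePath k).Free G) {M : ℕ} (hM : 0 < M) :
    ({v | Fintype.card V / M < G.degree v} : Finset V).card ≤ 2 * k * M := by
  set H : Finset V := {v | Fintype.card V / M < G.degree v}
  rcases isEmpty_or_nonempty V with _ | _
  · simp [Finset.eq_empty_of_isEmpty]
  have hdeg (v : V) (hv : v ∈ H) : Fintype.card V ≤ M * G.degree v :=
    ((Nat.div_lt_iff_lt_mul hM).1 (Finset.mem_filter.1 hv).2).le.trans_eq (mul_comm _ _)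
  refine Nat.le_of_mul_le_mul_right ?_ (Fintype.card_pos (α := V))
  calc H.card * Fintype.card V ≤ ∑ v ∈ H, M * G.degree v := H.card_nsmul_le_sum _ _ hdeg
    _ ≤ ∑ v, M * G.degree v := Finset.sum_le_univ_sum_of_nonneg fun _ => Nat.zero_le _
    _ ≤ M * (2 * k * Fintype.card V) := by
      rw [← Finset.mul_sum]
      exact Nat.mul_le_mul_left _ (sum_degree_le hfree)
    _ = 2 * k * M * Fintype.card V := by ring

lemma card_filter_lt_card_le (hfree : (edgePath k).Free G) (hk : k ≤ 2 * t + 2) (H : Finset V) :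
    ({c | t < {b ∈ H | G.Adj b c}.card} : Finset V).card ≤ H.card.choose (t + 1) * (t + 1) := by
  classical
  have hcover : ({c | t < {b ∈ H | G.Adj b c}.card} : Finset V) ⊆
      (H.powersetCard (t + 1)).biUnion fun D => {c | ∀ a ∈ D, G.Adj a c} := fun c hc => by
    obtain ⟨D, hD, hcard⟩ := Finset.exists_subset_card_eq (Finset.mem_filter.1 hc).2
    have hDH (a : V) (ha : a ∈ D) := Finset.mem_filter.1 (hD ha)
    exact Finset.mem_biUnion.2 ⟨D, Finset.mem_powersetCard.2 ⟨fun a ha => (hDH a ha).1, hcard⟩,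
      Finset.mem_filter.2 ⟨Finset.mem_univ _, fun a ha => (hDH a ha).2⟩⟩
  refine (Finset.card_le_card hcover).trans ?_
  rw [← Finset.card_powersetCard]
  refine Finset.card_biUnion_le_card_mul _ _ _ fun D hD => ?_
  have hcard := (Finset.mem_powersetCard.1 hD).2
  refine hcard ▸ card_le_card_of_isCompleteBetween (A := D) hfree
    (fun a ha c hc => (Finset.mem_filter.1 hc).2 a ha) (Finset.card_pos.1 ?_) ?_ <;> omega

/-- The coefficient of the quadratic error term in `mul_card_pathTuples_add_pow_le`. The threshold
for a high degree is `n / (16 * k ^ 2 * q)`, so that there are at most `32 * k ^ 3 * q` vertices of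
high degree. -/
def stabilityConst (k t q : ℕ) : ℕ :=
  2 * ((32 * k ^ 3 * q).choose (t + 1) * (t + 1)) * (q * (32 * k ^ 3 * q) ^ 2 + 1)

lemma mul_sum_offDiag_degree_add_le {H : Finset V} {c : V} (ht : 2 ≤ t) (hq : 0 < q)
    (hlow : ∀ A : Finset V, A.card = t →
      ∃ a ∈ A, q * G.degree a + Fintype.card V ≤ q * Fintype.card V) :
    q * ∑ p ∈ {b ∈ H | G.Adj b c}.offDiag, G.degree p.1 * G.degree p.2 + Fintype.card V ^ 2 ≤
      q * (t * (t - 1) * Fintype.card V ^ 2) +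
        if t < {b ∈ H | G.Adj b c}.card then (q * H.card ^ 2 + 1) * Fintype.card V ^ 2 else 0 := by
  set S := {b ∈ H | G.Adj b c}
  have hdeg (v : V) (_ : v ∈ S) : G.degree v ≤ Fintype.card V := G.degree_lt_card_verts v |>.le
  split_ifs with hc
  · have hS : S.card ≤ H.card := Finset.card_filter_le _ _
    calc _ ≤ q * (S.card * (S.card - 1) * Fintype.card V ^ 2) + Fintype.card V ^ 2 := by
          gcongr
          exact sum_offDiag_mul_le hdeg
      _ ≤ q * (H.card * H.card * Fintype.card V ^ 2) + Fintype.card V ^ 2 := by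
          gcongr
          exact (Nat.sub_le _ _).trans hS
      _ = (q * H.card ^ 2 + 1) * Fintype.card V ^ 2 := by ring
      _ ≤ _ := Nat.le_add_left _ _
  · by_contra! h
    obtain ⟨hcard, hhigh⟩ :=
      card_eq_and_forall_lt_of_lt_mul_sum_offDiag hdeg hq ht (not_lt.1 hc) (by simpa using h)
    obtain ⟨a, ha, hle⟩ := hlow S hcard
    exact (hhigh a ha).not_ge hle

lemma mul_sum_sum_offDiag_degree_add_le {H : Finset V} (ht : 2 ≤ t) (hq : 0 < q)
    (hlow : ∀ A : Finset V, A.card = t →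
      ∃ a ∈ A, q * G.degree a + Fintype.card V ≤ q * Fintype.card V) :
    q * (∑ c, ∑ p ∈ {b ∈ H | G.Adj b c}.offDiag, G.degree p.1 * G.degree p.2) +
        Fintype.card V ^ 3 ≤
      q * (t * (t - 1) * Fintype.card V ^ 3) +
        ({c | t < {b ∈ H | G.Adj b c}.card} : Finset V).card *
          ((q * H.card ^ 2 + 1) * Fintype.card V ^ 2) := by
  set n := Fintype.card V
  calc _ = ∑ c, (q * ∑ p ∈ {b ∈ H | G.Adj b c}.offDiag, G.degree p.1 * G.degree p.2 + n ^ 2) := by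
        rw [Finset.sum_add_distrib, ← Finset.mul_sum, Finset.sum_const, Finset.card_univ,
          smul_eq_mul]
        ring
    _ ≤ ∑ c, (q * (t * (t - 1) * n ^ 2) +
        if t < {b ∈ H | G.Adj b c}.card then (q * H.card ^ 2 + 1) * n ^ 2 else 0) :=
        Finset.sum_le_sum fun c _ => mul_sum_offDiag_degree_add_le ht hq hlow
    _ = _ := by
        rw [Finset.sum_add_distrib, ← Finset.sum_filter, Finset.sum_const, Finset.sum_const,
          Finset.card_univ, smul_eq_mul, smul_eq_mul]
        ring

lemma mul_card_pathTuples_add_pow_le (hfree : (edgePath k).Free G) (hk : 0 < k)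
    (hkt : k ≤ 2 * t + 2) (ht : 2 ≤ t) (hq : 0 < q)
    (hlow : ∀ A : Finset V, A.card = t →
      ∃ a ∈ A, q * G.degree a + Fintype.card V ≤ q * Fintype.card V) :
    2 * q * (pathTuples G).card + Fintype.card V ^ 3 ≤
      2 * q * (t * (t - 1) * Fintype.card V ^ 3) + stabilityConst k t q * Fintype.card V ^ 2 := by
  classical
  have hM : 0 < 16 * k ^ 2 * q := by positivity
  set n := Fintype.card V
  set H : Finset V := {v | n / (16 * k ^ 2 * q) < G.degree v} with hHdef
  set Z : Finset V := {c | t < {b ∈ H | G.Adj b c}.card}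
  have hH : H.card ≤ 32 * k ^ 3 * q :=
    (card_filter_div_lt_degree_le hfree hM).trans_eq (by ring)
  have hZ : Z.card ≤ (32 * k ^ 3 * q).choose (t + 1) * (t + 1) :=
    (card_filter_lt_card_le hfree hkt H).trans
      (Nat.mul_le_mul_right _ (Nat.choose_le_choose _ hH))
  have hcount := card_pathTuples_le_sum_degree_mul (Δ := n / (16 * k ^ 2 * q)) hfree (H := H)
    (by simp [hHdef])
  set T := ∑ c, ∑ p ∈ {b ∈ H | G.Adj b c}.offDiag, G.degree p.1 * G.degree p.2
  have hlight : 2 * q * (2 * (n / (16 * k ^ 2 * q)) * (2 * k * n) ^ 2) ≤ n ^ 3 :=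
    calc _ = (16 * k ^ 2 * q) * (n / (16 * k ^ 2 * q)) * n ^ 2 := by ring
      _ ≤ n * n ^ 2 := by gcongr; exact Nat.mul_div_le _ _
      _ = n ^ 3 := by ring
  have hsum : q * T + n ^ 3 ≤ q * (t * (t - 1) * n ^ 3) + Z.card * ((q * H.card ^ 2 + 1) * n ^ 2) :=
    mul_sum_sum_offDiag_degree_add_le ht hq hlow
  have hexceptional : 2 * (Z.card * ((q * H.card ^ 2 + 1) * n ^ 2)) ≤
      stabilityConst k t q * n ^ 2 := by
    rw [stabilityConst, ← mul_assoc, ← mul_assoc]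
    gcongr
  have := Nat.mul_le_mul_left (2 * q) hcount
  linarith

lemma exists_card_eq_forall_lt_degree (hfree : (edgePath k).Free G) (hk : 0 < k)
    (hkt : k ≤ 2 * t + 2) (ht : 2 ≤ t) (hq : 0 < q) {c : ℕ}
    (hcard : stabilityConst k t q + 2 * q * c < Fintype.card V)
    (hlower : t * (t - 1) * Fintype.card V ^ 3 ≤ (pathTuples G).card + c * Fintype.card V ^ 2) :
    ∃ A : Finset V, A.card = t ∧
      ∀ a ∈ A, q * Fintype.card V < q * G.degree a + Fintype.card V := by
  by_contra! hlow
  have hupper := mul_card_pathTuples_add_pow_le hfree hk hkt ht hq hlow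
  have hlower' := Nat.mul_le_mul_left (2 * q) hlower
  have hlt := Nat.mul_lt_mul_of_pos_right hcard
    (pow_pos ((Nat.zero_le _).trans_lt hcard) 2 : 0 < Fintype.card V ^ 2)
  rw [(by ring : Fintype.card V * Fintype.card V ^ 2 = Fintype.card V ^ 3)] at hlt
  linarith

end Stability

section ExtremalCore

open SimpleGraph

variable {V : Type*} [Fintype V] {G : SimpleGraph V} {k : ℕ} {A : Finset V}

lemma mul_card_compl_commonNeighbors_le [DecidableEq V] [DecidableRel G.Adj] {q : ℕ}
    (hdeg : ∀ a ∈ A, q * Fintype.card V < q * G.degree a + Fintype.card V) :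
    q * ({v | ∀ a ∈ A, G.Adj a v} : Finset V)ᶜ.card ≤ A.card * Fintype.card V := by
  have hcover : ({v | ∀ a ∈ A, G.Adj a v} : Finset V)ᶜ ⊆
      A.biUnion fun a => (G.neighborFinset a)ᶜ := fun v hv => by
    simpa using hv
  have hmissing (a : V) (ha : a ∈ A) : q * (G.neighborFinset a)ᶜ.card ≤ Fintype.card V := by
    have hlt := hdeg a ha
    rw [← Finset.card_add_card_compl (G.neighborFinset a), card_neighborFinset_eq_degree,
      mul_add] at hlt
    rw [← Finset.card_add_card_compl (G.neighborFinset a), card_neighborFinset_eq_degree]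
    omega
  calc q * ({v | ∀ a ∈ A, G.Adj a v} : Finset V)ᶜ.card
      ≤ q * ∑ a ∈ A, (G.neighborFinset a)ᶜ.card := by
        gcongr
        exact (Finset.card_le_card hcover).trans Finset.card_biUnion_le
    _ = ∑ a ∈ A, q * (G.neighborFinset a)ᶜ.card := Finset.mul_sum _ _ _
    _ ≤ A.card * Fintype.card V := A.sum_le_card_nsmul _ _ hmissing

lemma sq_add_mul_lt_mul_self_sub {k a r b n : ℕ} (hk : 0 < k) (hr : 8 * k * r ≤ n)
    (hn : n ≤ 2 * b) (hb : b ≤ n) (hlarge : 128 * k * (k + 1) * (a + 1) < n) :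
    (2 * k * r) ^ 2 + 16 * k * (k + 1) * a * n < b * b - b := by
  have hloss : 16 * (2 * k * r) ^ 2 ≤ n ^ 2 :=
    calc 16 * (2 * k * r) ^ 2 = (8 * k * r) ^ 2 := by ring
      _ ≤ n ^ 2 := by gcongr
  have hsq : n ^ 2 ≤ 4 * (b * b) :=
    calc n ^ 2 ≤ (2 * b) ^ 2 := by gcongr
      _ = 4 * (b * b) := by ring
  have hlinear : (8 * (16 * k * (k + 1) * a) + 128) * n ≤ n ^ 2 := by
    rw [sq]
    gcongr
    nlinarith
  rw [Nat.lt_sub_iff_add_lt]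
  have hpos : 0 < n := (Nat.zero_le _).trans_lt hlarge
  have := Nat.zero_le (16 * k * (k + 1) * a * n)
  linarith

lemma IsPathExtremal.isCompleteBetween_compl [DecidableEq V] [DecidableRel G.Adj]
    (hG : IsPathExtremal k G) (hA : 2 ≤ A.card) (hk : 0 < k) (hkA : k ≤ 2 * A.card + 2)
    (hdeg : ∀ a ∈ A, 8 * k * A.card * Fintype.card V <
      8 * k * A.card * G.degree a + Fintype.card V)
    (hlarge : 128 * k * (k + 1) * (A.card + 1) < Fintype.card V) :
    G.IsCompleteBetween A ↑Aᶜ := by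
  set B : Finset V := {v | ∀ a ∈ A, G.Adj a v} with hB
  have hAB : G.IsCompleteBetween A B := fun a ha v hv => (Finset.mem_filter.1 hv).2 a ha
  have hmissing : 8 * k * Bᶜ.card ≤ Fintype.card V := by
    have := mul_card_compl_commonNeighbors_le hdeg
    refine Nat.le_of_mul_le_mul_left (c := A.card) ?_ (by omega)
    linarith
  have hsplit := Finset.card_add_card_compl B
  have hBc : 2 * Bᶜ.card ≤ Fintype.card V := le_trans (by gcongr; omega) hmissing
  have hr : (A ∪ B)ᶜ.card ≤ Bᶜ.card :=
    Finset.card_le_card (Finset.compl_subset_compl.2 Finset.subset_union_right)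
  have hquad : (2 * k * (A ∪ B)ᶜ.card) ^ 2 + 16 * k * (k + 1) * A.card * Fintype.card V <
      B.card * B.card - B.card :=
    sq_add_mul_lt_mul_self_sub hk ((Nat.mul_le_mul_left _ hr).trans hmissing) (by omega)
      B.card_le_univ hlarge
  have hconst : 4 * (k + 1) + 2 * A.card + 6 ≤ 128 * k * (k + 1) * (A.card + 1) :=
    calc _ ≤ 128 * 1 * (k + 1) * (A.card + 1) := by nlinarith
      _ ≤ _ := by gcongr; exact hk
  have huniv := union_eq_univ_of_isPathExtremal hG hAB (fun v hv => by simpa [hB] using hv) hA hkA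
    (by omega) (by omega) hquad
  intro a ha v hv
  have hv' : v ∈ A ∪ B := huniv ▸ Finset.mem_univ v
  exact hAB ha ((Finset.mem_union.1 hv').resolve_left (by simpa using hv))

end ExtremalCore

section KopylovGraph

open SimpleGraph

variable {n k t : ℕ}

lemma kopylovGraph_adj {i j : Fin n} : (kopylovGraph n k t).Adj i j ↔
    i ≠ j ∧ (i.val < t ∨ j.val < t ∨ (i.val < k - t ∧ j.val < k - t)) := Iff.rfl

lemma card_filter_val_lt_le {ι : Type*} [Fintype ι] {f : ι → Fin n} (hf : f.Injective) :
    ({i | (f i).val < t} : Finset ι).card ≤ t := by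
  rw [← Finset.card_range t]
  refine Finset.card_le_card_of_injOn (fun i => (f i).val) (fun i hi => ?_)
    (Fin.val_injective.comp hf).injOn
  simpa using hi

lemma kopylovGraph_free (hkt : 2 * t < k) : (edgePath k).Free (kopylovGraph n k t) := by
  rintro ⟨f⟩
  have hadj (i : Fin k) : (kopylovGraph n k t).Adj (f i.castSucc) (f i.succ) :=
    f.toHom.map_adj (edgePath_adj.2 (Or.inl rfl))
  let S₁ : Finset (Fin k) := {i | (f i.castSucc).val < t}
  let S₂ : Finset (Fin k) := {i | (f i.succ).val < t}
  let S₃ : Finset (Fin k) := {i | t ≤ (f i.castSucc).val ∧ t ≤ (f i.succ).val}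
  have hS₁ : S₁.card ≤ t := card_filter_val_lt_le (f.injective.comp (Fin.castSucc_injective k))
  have hS₂ : S₂.card ≤ t := card_filter_val_lt_le (f.injective.comp (Fin.succ_injective k))
  -- A path has fewer edges than vertices inside the class `C`.
  have hS₃ : S₃.card ≤ k - t - t - 1 := by
    rcases S₃.eq_empty_or_nonempty with h | h
    · simp [h]
    have hC (i : Fin k) (hi : i ∈ S₃) :
        (f i.castSucc).val ∈ Finset.Ico t (k - t) ∧ (f i.succ).val ∈ Finset.Ico t (k - t) := by
      have hi' := (Finset.mem_filter.1 hi).2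
      have hadj' := (kopylovGraph_adj.1 (hadj i)).2
      simp only [Finset.mem_Ico]
      omega
    rw [← Nat.card_Ico t (k - t), ← Finset.card_erase_of_mem (hC _ (S₃.min'_mem h)).1]
    refine Finset.card_le_card_of_injOn (fun i => (f i.succ).val) (fun i hi => ?_)
      ((Fin.val_injective.comp (f.injective.comp (Fin.succ_injective k))).injOn)
    refine Finset.mem_coe.2 (Finset.mem_erase.2 ⟨fun heq => ?_, (hC i hi).2⟩)
    have hsucc := f.injective (Fin.ext heq)
    have hmin := S₃.min'_le i hi
    rw [Fin.ext_iff, Fin.val_succ, Fin.val_castSucc] at hsucc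
    rw [Fin.le_def] at hmin
    omega
  have hcover : Finset.univ ⊆ S₁ ∪ (S₂ ∪ S₃) := fun i _ => by
    simp only [S₁, S₂, S₃, Finset.mem_union, Finset.mem_filter, Finset.mem_univ, true_and]
    omega
  have hcard := Finset.card_le_card hcover
  rw [Finset.card_univ, Fintype.card_fin] at hcard
  have := Finset.card_union_le S₁ (S₂ ∪ S₃)
  have := Finset.card_union_le S₂ S₃
  omega

lemma card_pathTuples_kopylovGraph_le (hkt : 2 * t < k) :
    (pathTuples (kopylovGraph n k t)).card ≤ t * (t - 1) * n ^ 3 + 8 * k ^ 3 * n ^ 2 := by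
  classical
  let A : Finset (Fin n) := {i | i.val < t}
  have hA : A.card ≤ t := card_filter_val_lt_le Function.injective_id
  have hdeg (v : Fin n) (hv : v ∉ A) : (kopylovGraph n k t).degree v ≤ k := by
    rw [← card_neighborFinset_eq_degree]
    have hle := card_filter_val_lt_le (t := k - t) (Function.injective_id (α := Fin n))
    refine (Finset.card_le_card fun w hw => ?_).trans (hle.trans (Nat.sub_le _ _))
    have hadj := (kopylovGraph_adj.1 ((mem_neighborFinset _ _ _).1 hw)).2
    simp only [A, Finset.mem_filter, Finset.mem_univ, true_and, id] at hv ⊢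
    omega
  have hcore (c : Fin n) : ∑ p ∈ {b ∈ A | (kopylovGraph n k t).Adj b c}.offDiag,
      (kopylovGraph n k t).degree p.1 * (kopylovGraph n k t).degree p.2 ≤
      t * (t - 1) * n ^ 2 := by
    have hle := (Finset.card_filter_le A fun b => (kopylovGraph n k t).Adj b c).trans hA
    have hdeg_le (v : Fin n) : (kopylovGraph n k t).degree v ≤ n := by
      simpa using ((kopylovGraph n k t).degree_lt_card_verts v).le
    refine (sum_offDiag_mul_le (w := fun v => (kopylovGraph n k t).degree v)
      fun v _ => hdeg_le v).trans ?_
    gcongr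
  refine (card_pathTuples_le_sum_degree_mul (kopylovGraph_free hkt) hdeg).trans ?_
  calc _ ≤ (∑ _ : Fin n, t * (t - 1) * n ^ 2) + 2 * k * (2 * k * Fintype.card (Fin n)) ^ 2 := by
        gcongr with c
        exact hcore c
    _ = t * (t - 1) * n ^ 3 + 8 * k ^ 3 * n ^ 2 := by
        rw [Finset.sum_const, Finset.card_univ, Fintype.card_fin, smul_eq_mul]
        ring

end KopylovGraph

section CompleteBipartiteLowerBound

open SimpleGraph

lemma pow_three_le_sub_pow_three_add (n s : ℕ) : n ^ 3 ≤ (n - s) ^ 3 + 3 * s * n ^ 2 := by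
  rcases le_total n s with hle | hle
  · calc n ^ 3 = n * n ^ 2 := by ring
      _ ≤ 3 * s * n ^ 2 := by gcongr; omega
      _ ≤ _ := Nat.le_add_left _ _
  · obtain ⟨m, rfl⟩ := Nat.exists_eq_add_of_le' hle
    rw [Nat.add_sub_cancel]
    nlinarith [Nat.zero_le (m * s ^ 2), Nat.zero_le (s ^ 3)]

variable {V : Type*} [Fintype V] [DecidableEq V] {G : SimpleGraph V} {A : Finset V}

lemma card_mul_pow_le_card_pathTuples (hA : G.IsCompleteBetween A ↑Aᶜ) :
    A.card * (A.card - 1) * (Fintype.card V - A.card - 2) ^ 3 ≤ (pathTuples G).card := by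
  calc _ ≤ A.card * (A.card - 1) * (Fintype.card V - A.card).descFactorial 3 := by
        gcongr
        exact Nat.pow_sub_le_descFactorial _ 3
    _ = (A.offDiag ×ˢ (Finset.univ : Finset (Fin 3 ↪ ↥(Aᶜ)))).card := by
        rw [Finset.card_product, Finset.offDiag_card, Finset.card_univ, Fintype.card_embedding_eq,
          Fintype.card_coe, Fintype.card_fin, Finset.card_compl, Nat.mul_sub_one]
    _ ≤ (pathTuples G).card := by
        refine Finset.card_le_card_of_injOn
          (fun p => ((p.2 0).1, p.1.1, (p.2 1).1, p.1.2, (p.2 2).1)) ?_ ?_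
        · rintro ⟨⟨a, a'⟩, g⟩ hp
          obtain ⟨ha, ha', hne⟩ := Finset.mem_offDiag.1 (Finset.mem_product.1 hp).1
          have hadj {a : V} (ha : a ∈ A) (i : Fin 3) : G.Adj a (g i) := hA ha (g i).2
          have hg {i j : Fin 3} (hij : i ≠ j) : (g i).1 ≠ (g j).1 := fun h =>
            hij (g.injective (Subtype.ext h))
          refine mem_pathTuples.2 ⟨⟨(hadj ha 0).symm, hadj ha 1, (hadj ha' 1).symm, hadj ha' 2⟩, ?_⟩
          simp [(hadj ha _).ne, (hadj ha' _).ne, (hadj ha _).ne', (hadj ha' _).ne', hne,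
            hg (i := 0) (j := 1), hg (i := 0) (j := 2), hg (i := 1) (j := 2)]
        · rintro ⟨⟨a, a'⟩, g⟩ - ⟨⟨b, b'⟩, g'⟩ - h
          simp only [Prod.mk.injEq] at h
          obtain ⟨h₀, rfl, h₁, rfl, h₂⟩ := h
          refine Prod.ext rfl (DFunLike.ext _ _ fun i => Subtype.ext ?_)
          fin_cases i <;> assumption

lemma card_mul_pow_three_le (hA : G.IsCompleteBetween A ↑Aᶜ) :
    A.card * (A.card - 1) * Fintype.card V ^ 3 ≤ (pathTuples G).card +
      A.card * (A.card - 1) * (3 * (A.card + 2)) * Fintype.card V ^ 2 := by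
  have hpow := Nat.mul_le_mul_left (A.card * (A.card - 1))
    (pow_three_le_sub_pow_three_add (Fintype.card V) (A.card + 2))
  have hpaths := card_mul_pow_le_card_pathTuples hA
  rw [Nat.sub_sub] at hpaths
  linarith

end CompleteBipartiteLowerBound

section Labelling

open SimpleGraph

variable {n k t : ℕ}

lemma exists_equiv_fin_mem_iff {V : Type*} [Fintype V] {A C : Finset V}
    (hAC : Disjoint A C) : ∃ e : Fin (Fintype.card V) ≃ V,
      ∀ i, (e i ∈ A ↔ i.val < A.card) ∧ (e i ∈ C → i.val < A.card + C.card) := by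
  classical
  let l := A.toList ++ (C.toList ++ (A ∪ C)ᶜ.toList)
  have hdisj (v : V) (hA : v ∈ A) : v ∉ C.toList ++ (A ∪ C)ᶜ.toList := by
    simp [hA, Finset.disjoint_left.1 hAC hA]
  have hnodup : l.Nodup := by
    refine List.nodup_append'.2 ⟨A.nodup_toList, List.nodup_append'.2
      ⟨C.nodup_toList, Finset.nodup_toList _, fun v hv => ?_⟩, fun v hv => ?_⟩
    · simp [Finset.mem_toList.1 hv]
    · exact hdisj v (Finset.mem_toList.1 hv)
  have hmem (v : V) : v ∈ l := by
    simp only [l, List.mem_append, Finset.mem_toList, Finset.mem_compl, Finset.mem_union]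
    tauto
  let e := hnodup.getEquivOfForallMemList l hmem
  have hlength : Fintype.card V = l.length := by
    rw [← Fintype.card_congr e, Fintype.card_fin]
  refine ⟨(finCongr hlength).trans e, fun i => ?_⟩
  have hi : i.val < l.length := hlength ▸ i.isLt
  change (l[i.val] ∈ A ↔ _) ∧ (l[i.val] ∈ C → _)
  rcases lt_or_ge i.val A.card with hA | hA
  · have hiA : l[i.val] ∈ A := by
      rw [List.getElem_append_left (by simpa using hA)]
      exact Finset.mem_toList.1 (List.getElem_mem _)
    exact ⟨iff_of_true hiA hA, fun _ => hA.trans_le (Nat.le_add_right _ _)⟩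
  · rw [List.getElem_append_right (by simpa using hA)]
    refine ⟨iff_of_false (fun h => hdisj _ h (List.getElem_mem _)) hA.not_gt, fun h => ?_⟩
    by_contra! hC
    rw [List.getElem_append_right (by simp only [Finset.length_toList]; omega)] at h
    have hrest := Finset.mem_toList.1 (List.getElem_mem (l := (A ∪ C)ᶜ.toList)
      (n := i.val - A.toList.length - C.toList.length)
      (by simp only [l, List.length_append, Finset.length_toList] at hi ⊢; omega))
    exact Finset.mem_compl.1 hrest (Finset.mem_union_right _ h)

/-- The complete bipartite graph between the class `A` of `kopylovGraph n k t` and the remaining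
vertices. -/
def kopylovBipartite (n t : ℕ) : SimpleGraph (Fin n) where
  Adj i j := (i.val < t ∧ t ≤ j.val) ∨ (j.val < t ∧ t ≤ i.val)
  symm := ⟨fun _ _ h => h.symm⟩
  loopless := ⟨fun i (h : _ ∨ _) => by omega⟩

lemma kopylovBipartite_adj {i j : Fin n} : (kopylovBipartite n t).Adj i j ↔
    (i.val < t ∧ t ≤ j.val) ∨ (j.val < t ∧ t ≤ i.val) := Iff.rfl

lemma kopylovBipartite_le_kopylovGraph : kopylovBipartite n t ≤ kopylovGraph n k t := by
  intro i j h
  refine kopylovGraph_adj.2 ⟨h.ne, ?_⟩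
  rw [kopylovBipartite_adj] at h
  tauto

lemma isCompleteBetween_kopylovBipartite :
    (kopylovBipartite n t).IsCompleteBetween
      ↑({i | i.val < t} : Finset (Fin n)) ↑({i | i.val < t} : Finset (Fin n))ᶜ := by
  intro i hi j hj
  exact Or.inl ⟨by simpa using hi, by simpa using hj⟩

/-- The isomorphism that identifies the first class of the complete bipartite graph with the first
`t` vertices. -/
def kopylovBipartiteIso (h : t ≤ n) :
    completeBipartiteGraph (Fin t) (Fin (n - t)) ≃g kopylovBipartite n t where
  toEquiv := finSumFinEquiv.trans (finCongr (Nat.add_sub_cancel' h))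
  map_rel_iff' := by
    rintro (i | i) (j | j) <;> simp [kopylovBipartite_adj]

lemma exists_iso_between {V : Type*} [Fintype V] [DecidableEq V] {G : SimpleGraph V}
    {A C : Finset V} (hn : Fintype.card V = n) (hA : G.IsCompleteBetween A ↑Aᶜ)
    (hAC : Disjoint A C) (hC : C.card ≤ k - 2 * A.card)
    (hadj : ∀ u v, G.Adj u v → u ∈ A ∨ v ∈ A ∨ u ∈ C ∧ v ∈ C) :
    ∃ G' : SimpleGraph (Fin n), Nonempty (G ≃g G') ∧
      kopylovBipartite n A.card ≤ G' ∧ G' ≤ kopylovGraph n k A.card := by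
  subst hn
  obtain ⟨e, he⟩ := exists_equiv_fin_mem_iff hAC
  refine ⟨G.comap e, ⟨(Iso.comap e G).symm⟩, fun i j hij => ?_, fun i j hij => ?_⟩
  · have hmem (i j : Fin (Fintype.card V)) (hi : i.val < A.card) (hj : A.card ≤ j.val) :
        G.Adj (e i) (e j) :=
      hA ((he i).1.2 hi) (by simpa [(he j).1] using hj)
    exact hij.elim (fun h => hmem i j h.1 h.2) (fun h => (hmem j i h.1 h.2).symm)
  · refine kopylovGraph_adj.2 ⟨hij.ne, ?_⟩
    rcases hadj _ _ hij with hi | hj | ⟨hi, hj⟩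
    · exact Or.inl ((he i).1.1 hi)
    · exact Or.inr (Or.inl ((he j).1.1 hj))
    · have := (he i).2 hi
      have := (he j).2 hj
      omega

end Labelling

section Rigidity

open SimpleGraph

variable {n k t : ℕ} {G : SimpleGraph (Fin n)} {i j : Fin n}

lemma mem_pathTuples_iff_ne {V : Type*} [Fintype V] {G : SimpleGraph V} {a b c d e : V} :
    (a, b, c, d, e) ∈ pathTuples G ↔ (G.Adj a b ∧ G.Adj b c ∧ G.Adj c d ∧ G.Adj d e) ∧
      (a ≠ b ∧ a ≠ c ∧ a ≠ d ∧ a ≠ e) ∧ (b ≠ c ∧ b ≠ d ∧ b ≠ e) ∧ (c ≠ d ∧ c ≠ e) ∧ d ≠ e := by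
  simp [mem_pathTuples, and_assoc]

lemma adj_of_pathTuples_eq_of_lt_of_lt
    (hpaths : pathTuples G = pathTuples (kopylovGraph n k t)) (ht : 2 ≤ t) (hk : 6 ≤ k)
    (hkt : 2 * t < k) (hn : k < n)
    (hij : i ≠ j) (hi : i.val < t) (hj : j.val < t) : G.Adj i j := by
  rcases ht.eq_or_lt with rfl | ht
  · have hmem : ((⟨2, by omega⟩, ⟨3, by omega⟩, i, j, ⟨n - 1, by omega⟩) :
        Fin n × Fin n × Fin n × Fin n × Fin n) ∈ pathTuples G := by
      rw [hpaths]
      simp only [mem_pathTuples_iff_ne, kopylovGraph_adj, Fin.ext_iff, ne_eq] at *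
      omega
    exact (mem_pathTuples.1 hmem).1.2.2.1
  · obtain ⟨a, ha, haij⟩ := Finset.exists_mem_notMem_of_card_lt_card
      (show ({i.val, j.val} : Finset ℕ).card < (Finset.range t).card by
        grw [Finset.card_le_two, Finset.card_range]; exact ht)
    simp only [Finset.mem_range, Finset.mem_insert, Finset.mem_singleton, not_or] at ha haij
    have hmem : ((⟨n - 1, by omega⟩, i, j, ⟨n - 2, by omega⟩, ⟨a, by omega⟩) :
        Fin n × Fin n × Fin n × Fin n × Fin n) ∈ pathTuples G := by
      rw [hpaths]
      simp only [mem_pathTuples_iff_ne, kopylovGraph_adj, Fin.ext_iff, ne_eq] at *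
      omega
    exact (mem_pathTuples.1 hmem).1.2.1

lemma adj_of_pathTuples_eq_of_le_of_le
    (hpaths : pathTuples G = pathTuples (kopylovGraph n k t)) (ht : 2 ≤ t) (hn : k < n)
    (hij : (kopylovGraph n k t).Adj i j) (hi : t ≤ i.val) (hj : t ≤ j.val) : G.Adj i j := by
  have hmem : ((i, j, ⟨0, by omega⟩, ⟨n - 1, by omega⟩, ⟨1, by omega⟩) :
      Fin n × Fin n × Fin n × Fin n × Fin n) ∈ pathTuples G := by
    rw [hpaths]
    simp only [mem_pathTuples_iff_ne, kopylovGraph_adj, Fin.ext_iff, ne_eq] at *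
    omega
  exact (mem_pathTuples.1 hmem).1.1

lemma eq_kopylovGraph_of_pathTuples_eq (hbip : kopylovBipartite n t ≤ G)
    (hkop : G ≤ kopylovGraph n k t)
    (hpaths : pathTuples G = pathTuples (kopylovGraph n k t)) (ht : 2 ≤ t) (hk : 6 ≤ k)
    (hkt : 2 * t < k) (hn : k < n) : G = kopylovGraph n k t := by
  refine le_antisymm hkop fun i j hij => ?_
  rcases lt_or_ge i.val t with hi | hi <;> rcases lt_or_ge j.val t with hj | hj
  · exact adj_of_pathTuples_eq_of_lt_of_lt hpaths ht hk hkt hn hij.ne hi hj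
  · exact hbip (Or.inl ⟨hi, hj⟩)
  · exact hbip (Or.inr ⟨hj, hi⟩)
  · exact adj_of_pathTuples_eq_of_le_of_le hpaths ht hn hij hi hj

lemma eq_kopylovGraph_or_eq_kopylovBipartite (hbip : kopylovBipartite n 2 ≤ G)
    (hkop : G ≤ kopylovGraph n 5 2) : G = kopylovGraph n 5 2 ∨ G = kopylovBipartite n 2 := by
  have hedge {i j : Fin n} : (kopylovGraph n 5 2).Adj i j ↔
      (kopylovBipartite n 2).Adj i j ∨ i.val = 0 ∧ j.val = 1 ∨ i.val = 1 ∧ j.val = 0 := by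
    rw [kopylovGraph_adj, kopylovBipartite_adj, ne_eq, Fin.ext_iff]
    omega
  by_cases hcore : ∃ i j : Fin n, i.val = 0 ∧ j.val = 1 ∧ G.Adj i j
  · obtain ⟨i, j, hi, hj, hij⟩ := hcore
    refine Or.inl (le_antisymm hkop fun u v huv => ?_)
    rcases hedge.1 huv with huv | ⟨hu, hv⟩ | ⟨hu, hv⟩
    · exact hbip huv
    · rwa [Fin.ext (hu.trans hi.symm), Fin.ext (hv.trans hj.symm)]
    · rwa [Fin.ext (hu.trans hj.symm), Fin.ext (hv.trans hi.symm), adj_comm]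
  · refine Or.inr (le_antisymm (fun u v huv => ?_) hbip)
    rcases hedge.1 (hkop huv) with h | ⟨hu, hv⟩ | ⟨hu, hv⟩
    · exact h
    · exact absurd ⟨u, v, hu, hv, huv⟩ hcore
    · exact absurd ⟨v, u, hv, hu, huv.symm⟩ hcore

lemma pathTuples_kopylovBipartite_two :
    pathTuples (kopylovBipartite n 2) = pathTuples (kopylovGraph n 5 2) := by
  refine (pathTuples_mono kopylovBipartite_le_kopylovGraph).antisymm ?_
  rintro ⟨a, b, c, d, e⟩ hpath
  simp only [mem_pathTuples_iff_ne, kopylovGraph_adj, kopylovBipartite_adj, Fin.ext_iff,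
    ne_eq] at hpath ⊢
  have hb : b.val < 2 := by omega
  have hd : d.val < 2 := by omega
  omega

end Rigidity

section Extremal

open SimpleGraph

variable {n k t : ℕ}

lemma mul_pow_three_le_card_pathTuples_kopylovGraph (htn : t ≤ n) :
    t * (t - 1) * n ^ 3 ≤
      (pathTuples (kopylovGraph n k t)).card + t * (t - 1) * (3 * (t + 2)) * n ^ 2 := by
  have hbip := card_mul_pow_three_le (isCompleteBetween_kopylovBipartite (n := n) (t := t))
  have hcard : ({i | i.val < t} : Finset (Fin n)).card = t := by
    rw [Fin.card_filter_val_lt, min_eq_right htn]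
  rw [hcard, Fintype.card_fin] at hbip
  grw [hbip, pathTuples_mono (kopylovBipartite_le_kopylovGraph (k := k))]

lemma eventually_exists_iso_between (ht : 2 ≤ t) (hkt : 2 * t < k) (hkt' : k ≤ 2 * t + 2) :
    ∀ᶠ n in atTop, ∀ G : SimpleGraph (Fin n), IsPathExtremal k G →
      ∃ G' : SimpleGraph (Fin n), Nonempty (G ≃g G') ∧
        kopylovBipartite n t ≤ G' ∧ G' ≤ kopylovGraph n k t := by
  classical
  let q := 8 * k * t
  let c := t * (t - 1) * (3 * (t + 2))
  filter_upwards [eventually_gt_atTop (stabilityConst k t q + 2 * q * c),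
    eventually_gt_atTop (128 * k * (k + 1) * (t + 1)), eventually_ge_atTop (2 * t + 4)]
    with n hstable hlarge hn G hG
  have hq : 0 < q := by positivity [show 0 < k by omega, show 0 < t by omega]
  have hlower : t * (t - 1) * n ^ 3 ≤ (pathTuples G).card + c * n ^ 2 := by
    grw [mul_pow_three_le_card_pathTuples_kopylovGraph (k := k) (by omega),
      hG.2 _ (kopylovGraph_free hkt)]
  obtain ⟨A, rfl, hdeg⟩ := exists_card_eq_forall_lt_degree hG.1 (by omega) hkt' ht hq
    (by rwa [Fintype.card_fin]) (by rwa [Fintype.card_fin])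
  have hA := hG.isCompleteBetween_compl ht (by omega) hkt' hdeg (by rwa [Fintype.card_fin])
  obtain ⟨C, hAC, hC, hadj⟩ := exists_finset_forall_adj hG.1 hA ht hkt'
    (by rw [Finset.card_compl, Fintype.card_fin]; omega)
  exact exists_iso_between (Fintype.card_fin n) hA hAC hC hadj

lemma eventually_isPathExtremal_kopylovGraph (ht : 2 ≤ t) (hkt : 2 * t < k)
    (hkt' : k ≤ 2 * t + 2) : ∀ᶠ n in atTop, IsPathExtremal k (kopylovGraph n k t) := by
  filter_upwards [eventually_exists_iso_between ht hkt hkt'] with n hbetween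
  obtain ⟨G, hG⟩ := exists_isPathExtremal (kopylovGraph_free (n := n) hkt)
  obtain ⟨G', ⟨φ⟩, -, hle⟩ := hbetween G hG
  exact ⟨kopylovGraph_free hkt, fun H hH =>
    ((hG.congr φ).2 H hH).trans (Finset.card_le_card (pathTuples_mono hle))⟩

lemma IsPathExtremal.kopylovBipartite_two (h : IsPathExtremal 5 (kopylovGraph n 5 2)) :
    IsPathExtremal 5 (kopylovBipartite n 2) :=
  ⟨fun hcopy => h.1 (hcopy.mono_right kopylovBipartite_le_kopylovGraph),
    pathTuples_kopylovBipartite_two ▸ h.2⟩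

lemma eventually_isPathExtremal_iff (ht : 2 ≤ t) (hkt : 2 * t < k) (hkt' : k ≤ 2 * t + 2) :
    ∀ᶠ n in atTop, ∀ G : SimpleGraph (Fin n), IsPathExtremal k G ↔
      Nonempty (G ≃g kopylovGraph n k t) ∨
        k = 5 ∧ Nonempty (G ≃g completeBipartiteGraph (Fin 2) (Fin (n - 2))) := by
  filter_upwards [eventually_exists_iso_between ht hkt hkt',
    eventually_isPathExtremal_kopylovGraph ht hkt hkt', eventually_gt_atTop k]
    with n hbetween hkop hn G
  constructor
  · intro hG
    obtain ⟨G', ⟨φ⟩, hbip, hle⟩ := hbetween G hG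
    rcases (show 5 ≤ k by omega).eq_or_lt with rfl | hk
    · obtain rfl : t = 2 := by omega
      rcases eq_kopylovGraph_or_eq_kopylovBipartite hbip hle with rfl | rfl
      · exact Or.inl ⟨φ⟩
      · exact Or.inr ⟨rfl, ⟨φ.trans (kopylovBipartiteIso (by omega)).symm⟩⟩
    · have hpaths := Finset.eq_of_subset_of_card_le (pathTuples_mono hle)
        ((hG.congr φ).2 _ hkop.1)
      obtain rfl := eq_kopylovGraph_of_pathTuples_eq hbip hle hpaths ht hk hkt hn
      exact Or.inl ⟨φ⟩
  · rintro (⟨⟨φ⟩⟩ | ⟨rfl, ⟨φ⟩⟩)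
    · exact hkop.congr φ.symm
    · obtain rfl : t = 2 := by omega
      exact hkop.kopylovBipartite_two.congr (φ.trans (kopylovBipartiteIso (by omega))).symm

end Extremal

lemma isBigO_sub_mul_pow_three {f : ℕ → ℕ} {m c c' : ℕ}
    (hlower : ∀ᶠ n in atTop, m * n ^ 3 ≤ f n * 2 + c * n ^ 2)
    (hupper : ∀ᶠ n in atTop, f n * 2 ≤ m * n ^ 3 + c' * n ^ 2) :
    (fun n => (f n : ℝ) - m / 2 * n ^ 3) =O[atTop] fun n : ℕ => (n : ℝ) ^ 2 := by
  refine IsBigO.of_bound (c + c' : ℕ) ?_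
  filter_upwards [hlower, hupper] with n hlower hupper
  have hlower' : (m : ℝ) * n ^ 3 ≤ f n * 2 + c * n ^ 2 := mod_cast hlower
  have hupper' : (f n : ℝ) * 2 ≤ m * n ^ 3 + c' * n ^ 2 := mod_cast hupper
  have hc : 0 ≤ (c : ℝ) * n ^ 2 := by positivity
  have hc' : 0 ≤ (c' : ℝ) * n ^ 2 := by positivity
  rw [Real.norm_eq_abs, Real.norm_of_nonneg (by positivity), Nat.cast_add, abs_le]
  constructor <;> linarith

lemma isBigO_genExtremalNumber_sub {k t : ℕ} (ht : 2 ≤ t) (hkt : 2 * t < k)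
    (hkt' : k ≤ 2 * t + 2) :
    (fun n : ℕ => (genExtremalNumber n (edgePath 4) (edgePath k) : ℝ)
        - (t : ℝ) * ((t : ℝ) - 1) / 2 * (n : ℝ) ^ 3)
      =O[atTop] (fun n : ℕ => (n : ℝ) ^ 2) := by
  have hcard : ∀ᶠ n in atTop, genExtremalNumber n (edgePath 4) (edgePath k) * 2 =
      (pathTuples (kopylovGraph n k t)).card := by
    filter_upwards [eventually_isPathExtremal_kopylovGraph ht hkt hkt'] with n hkop
    rw [card_pathTuples, (isGenExtremal_iff.2 hkop).2]
  have hbound := isBigO_sub_mul_pow_three (m := t * (t - 1))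
    (f := fun n => genExtremalNumber n (edgePath 4) (edgePath k))
    (by filter_upwards [hcard, eventually_ge_atTop t] with n hn htn
        exact hn ▸ mul_pow_three_le_card_pathTuples_kopylovGraph htn)
    (by filter_upwards [hcard] with n hn
        exact hn ▸ card_pathTuples_kopylovGraph_le hkt)
  rwa [Nat.cast_mul, Nat.cast_pred (by omega)] at hbound

theorem theorem4p6 (k : ℕ) (hk : 5 ≤ k) (t : ℕ) (ht : t = (k - 1) / 2) :
    (∃ n₁ : ℕ, ∀ n : ℕ, n₁ ≤ n →
      genExtremalNumber n (edgePath 4) (edgePath k)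
          = (kopylovGraph n k t).copyCount (edgePath 4) ∧
      ∀ G : SimpleGraph (Fin n),
        IsGenExtremal (edgePath 4) (edgePath k) G ↔
          (Nonempty (G ≃g kopylovGraph n k t) ∨
            (k = 5 ∧ Nonempty (G ≃g completeBipartiteGraph (Fin 2) (Fin (n - 2)))))) ∧
    (fun n : ℕ => (genExtremalNumber n (edgePath 4) (edgePath k) : ℝ)
        - (t : ℝ) * ((t : ℝ) - 1) / 2 * (n : ℝ) ^ 3)
      =O[atTop] (fun n : ℕ => (n : ℝ) ^ 2) := by
  have ht2 : 2 ≤ t := by omega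
  have hkt : 2 * t < k := by omega
  have hkt' : k ≤ 2 * t + 2 := by omega
  refine ⟨eventually_atTop.1 ?_, isBigO_genExtremalNumber_sub ht2 hkt hkt'⟩
  filter_upwards [eventually_isPathExtremal_kopylovGraph ht2 hkt hkt',
    eventually_isPathExtremal_iff ht2 hkt hkt'] with n hkop hiff
  exact ⟨(isGenExtremal_iff.2 hkop).2.symm, fun G => isGenExtremal_iff.trans (hiff G)⟩
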